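/- Let $\tfrac12<H<1$ and let $(W_t)_{t\in[0,1]}$ be a standard Wiener process on a probability space. Put $\psi(s,t)=H(2H-1)|s-t|^{2H-2}$, and let $|\mathcal H|^{\otimes n}$ be the space of measurable $f:[0,1]^n\to\mathbb R$ with $$\int_{[0,1]^{2n}}|f(u)f(v)|\prod_{j=1}^n\psi(u_j,v_j)\,du\,dv<\infty .$$ Write $|\mathcal H|=|\mathcal H|^{\otimes 1}$ and $\langle f,g\rangle_{\mathcal H}=\int_0^1\!\int_0^1 f(u)g(v)\psi(u,v)\,du\,dv$ for $f,g\in|\mathcal H|$. For $f\in|\mathcal H|^{\otimes n}$ the multiple integral with respect to the fractional Brownian motion with Hurst parameter $H$ is $I_n^H(f)=I_n(\Gamma_H^{(n)}f)$. Here $I_n$ is the multiple Wiener–Itô integral of order $n$ with respect to $W$, that is, the continuous extension to $L^2([0,1]^n)$ of the map sending an elementary function $\sum c_{i_1,\dots,i_n}1_{A_{i_1}\times\dots\times A_{i_n}}$ (with finitely many pairwise disjoint Borel sets $A_i\subset[0,1]$ and coefficients that vanish whenever two indices coincide) to $\sum c_{i_1,\dots,i_n}W(A_{i_1})\cdots W(A_{i_n})$,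 where $W((a,b])=W_b-W_a$, extended to Borel sets by $L^2$-continuity; and $$(\Gamma_H^{(n)}f)(t)=\Big[\tfrac{c_H\,\Gamma(H+\frac12)}{\Gamma(H-\frac12)}\Big]^n\prod_{j=1}^n t_j^{\frac12-H}\int_{t_1}^1\!\!\cdots\!\int_{t_n}^1 f(x)\prod_{j=1}^n x_j^{H-\frac12}(x_j-t_j)^{H-\frac32}\,dx,\qquad c_H=\Big(\tfrac{2H\,\Gamma(\frac32-H)}{\Gamma(H+\frac12)\,\Gamma(2-2H)}\Big)^{1/2}.$$ Let $f_1,\dots,f_n\in|\mathcal H|$. Then $f_1\otimes\dots\otimes f_n\in|\mathcal H|^{\otimes n}$, its integral $I_n^H(f_1\otimes\cdots\otimes f_n)$ is well defined, and almost surely $$I_n^H(f_1\otimes\cdots\otimes f_n)=\prod_{i=1}^n I_1^H(f_i)+\sum_{l=1}^{\lfloor n/2\rfloor}\frac{(-1)^l}{2^l\,l!}\sum_{\substack{k_1,\dots,k_{2l}=1\\ k_j\text{ distinct}}}^n\Big(\prod_{u\in\{1,\dots,n\}\setminus\{k_1,\dots,k_{2l}\}}I_1^H(f_u)\Big)\langle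 f_{k_1},f_{k_2}\rangle_{\mathcal H}\cdots\langle f_{k_{2l-1}},f_{k_{2l}}\rangle_{\mathcal H}.$$ The factor $1/(2^l\,l!)$ means that each set $\{\{k_1,k_2\},\dots,\{k_{2l-1},k_{2l}\}\}$ of $l$ disjoint pairs of indices is counted exactly once. -/

import Mathlib

open MeasureTheory ProbabilityTheory Filter Topology

namespace FractionalChaos

/-- A standard Wiener process `(W_t)` indexed by `t ∈ [0,1]` on the probability space `(Ω, P)`:
it starts at `0`, has independent increments, `W_t - W_s ∼ N(0, t - s)`, and continuous paths. -/
structure IsWienerProcess {Ω : Type*} [MeasurableSpace Ω] (W : unitInterval → Ω → ℝ)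
    (P : Measure Ω) : Prop where
  zero : ∀ᵐ ω ∂P, W 0 ω = 0
  indep : HasIndepIncrements W P
  law : ∀ s t : unitInterval, s ≤ t →
    HasLaw (fun ω => W t ω - W s ω) (gaussianReal 0 (Real.toNNReal ((t : ℝ) - (s : ℝ)))) P
  cont : ∀ᵐ ω ∂P, Continuous (fun t => W t ω)

/-- Lebesgue measure on `[0,1]^n`. -/
noncomputable def cube (n : ℕ) : Measure (Fin n → ℝ) :=
  Measure.pi (fun _ => (volume : Measure ℝ).restrict (Set.Icc 0 1))

/-! ### The Gaussian random measure `A ↦ W(A)` on Borel subsets of `[0,1]` -/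

/-- A step function `∑ i, coeff i * 1_{(left i, right i]}` on `[0,1]`. -/
structure StepFunction where
  num : ℕ
  coeff : Fin num → ℝ
  left : Fin num → unitInterval
  right : Fin num → unitInterval
  left_le_right : ∀ i, left i ≤ right i

/-- The function represented by a step function. -/
noncomputable def StepFunction.toFun (s : StepFunction) (x : ℝ) : ℝ :=
  ∑ i, s.coeff i * (Set.Ioc (s.left i : ℝ) (s.right i : ℝ)).indicator (fun _ => (1 : ℝ)) x

/-- The integral of a step function against `W`, determined by `W((a, b]) = W_b - W_a`. -/
noncomputable def StepFunction.integral {Ω : Type*} (s : StepFunction)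
    (W : unitInterval → Ω → ℝ) (ω : Ω) : ℝ :=
  ∑ i, s.coeff i * (W (s.right i) ω - W (s.left i) ω)

/-- `X` is (a version of) `W(A)`: it is the `L²(P)`-limit of the integrals of step functions which
converge to `1_A` in `L²([0,1])`. -/
def IsNoise {Ω : Type*} [MeasurableSpace Ω] (W : unitInterval → Ω → ℝ) (P : Measure Ω)
    (A : Set ℝ) (X : Ω → ℝ) : Prop :=
  MemLp X 2 P ∧ ∃ s : ℕ → StepFunction,
    Tendsto (fun k => eLpNorm (fun x => A.indicator (fun _ => (1 : ℝ)) x - (s k).toFun x) 2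
      ((volume : Measure ℝ).restrict (Set.Icc 0 1))) atTop (𝓝 0) ∧
    Tendsto (fun k => eLpNorm (fun ω => X ω - (s k).integral W ω) 2 P) atTop (𝓝 0)

open Classical in
/-- The random variable `W(A)`, for `A` a Borel subset of `[0,1]` (defined up to a null set). -/
noncomputable def noise {Ω : Type*} [MeasurableSpace Ω] (W : unitInterval → Ω → ℝ)
    (P : Measure Ω) (A : Set ℝ) : Ω → ℝ :=
  if h : ∃ X, IsNoise W P A X then h.choose else 0

/-! ### Multiple Wiener–Itô integrals -/

/-- The data of an elementary function of `n` variables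
`∑ c_{i_1, …, i_n} 1_{A_{i_1} × ⋯ × A_{i_n}}`: pairwise disjoint Borel sets `A_i ⊆ [0,1]` and
coefficients which vanish as soon as two indices coincide. -/
structure Elementary (n : ℕ) where
  num : ℕ
  A : Fin num → Set ℝ
  measurableSet : ∀ i, MeasurableSet (A i)
  subset_Icc : ∀ i, A i ⊆ Set.Icc 0 1
  pairwise_disjoint : ∀ i j, i ≠ j → Disjoint (A i) (A j)
  c : (Fin n → Fin num) → ℝ
  c_eq_zero : ∀ (i : Fin n → Fin num) (j k : Fin n), j ≠ k → i j = i k → c i = 0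

/-- The function represented by the data of an elementary function. -/
noncomputable def Elementary.toFun {n : ℕ} (e : Elementary n) (x : Fin n → ℝ) : ℝ :=
  ∑ i : Fin n → Fin e.num, e.c i * ∏ j, (e.A (i j)).indicator (fun _ => (1 : ℝ)) (x j)

/-- `I_n` of an elementary function: `∑ c_{i_1, …, i_n} W(A_{i_1}) ⋯ W(A_{i_n})`. -/
noncomputable def Elementary.integral {Ω : Type*} [MeasurableSpace Ω] {n : ℕ} (e : Elementary n)
    (W : unitInterval → Ω → ℝ) (P : Measure Ω) (ω : Ω) : ℝ :=
  ∑ i : Fin n → Fin e.num, e.c i * ∏ j, noise W P (e.A (i j)) ω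

/-- `X` is (a version of) the multiple Wiener–Itô integral `I_n(f)`: the `L²(P)`-limit of `I_n(e_k)`
for elementary functions `e_k` converging to `f` in `L²([0,1]^n)`. -/
def IsMultipleIntegral {Ω : Type*} [MeasurableSpace Ω] (W : unitInterval → Ω → ℝ) (P : Measure Ω)
    {n : ℕ} (f : (Fin n → ℝ) → ℝ) (X : Ω → ℝ) : Prop :=
  MemLp X 2 P ∧ ∃ e : ℕ → Elementary n,
    Tendsto (fun k => eLpNorm (fun x => f x - (e k).toFun x) 2 (cube n)) atTop (𝓝 0) ∧
    Tendsto (fun k => eLpNorm (fun ω => X ω - (e k).integral W P ω) 2 P) atTop (𝓝 0)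

open Classical in
/-- The multiple Wiener–Itô integral `I_n(f)` of `f ∈ L²([0,1]^n)` (defined up to a null set). -/
noncomputable def multipleIntegral {Ω : Type*} [MeasurableSpace Ω] (W : unitInterval → Ω → ℝ)
    (P : Measure Ω) {n : ℕ} (f : (Fin n → ℝ) → ℝ) : Ω → ℝ :=
  if h : ∃ X, IsMultipleIntegral W P f X then h.choose else 0

/-! ### Multiple fractional integrals -/

/-- The kernel `ψ(s, t) = H (2H - 1) |s - t|^{2H - 2}`. -/
noncomputable def psi (H s t : ℝ) : ℝ := H * (2 * H - 1) * |s - t| ^ (2 * H - 2)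

/-- `f ∈ |𝓗|^{⊗n}`: `f` is measurable on `[0,1]^n` and
`∫_{[0,1]^{2n}} |f(u) f(v)| ∏ ψ(u_j, v_j) du dv < ∞`. -/
def MemAbsH (H : ℝ) {n : ℕ} (f : (Fin n → ℝ) → ℝ) : Prop :=
  AEStronglyMeasurable f (cube n) ∧
    Integrable (fun p : (Fin n → ℝ) × (Fin n → ℝ) =>
      |f p.1 * f p.2| * ∏ j, psi H (p.1 j) (p.2 j)) ((cube n).prod (cube n))

/-- `⟨f, g⟩_{𝓗^{⊗n}} = ∫_{[0,1]^{2n}} f(u) g(v) ∏ ψ(u_j, v_j) du dv`. -/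
noncomputable def innerH (H : ℝ) {n : ℕ} (f g : (Fin n → ℝ) → ℝ) : ℝ :=
  ∫ p : (Fin n → ℝ) × (Fin n → ℝ), f p.1 * g p.2 * ∏ j, psi H (p.1 j) (p.2 j)
    ∂((cube n).prod (cube n))

/-- The fractional integral `I_{t-}^{α,n} f`, evaluated at `x ∈ [0,t]^n`. -/
noncomputable def fracIntegral (α t : ℝ) {n : ℕ} (f : (Fin n → ℝ) → ℝ) (x : Fin n → ℝ) : ℝ :=
  1 / (Real.Gamma α) ^ n *
    ∫ s in Set.pi Set.univ (fun j => Set.Ioc (x j) t), f s / ∏ j, (s j - x j) ^ (1 - α)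

/-- The normalizing constant
`c_H = (2 H Γ(3/2 - H) / (Γ(H + 1/2) Γ(2 - 2H)))^{1/2}`. -/
noncomputable def cH (H : ℝ) : ℝ :=
  Real.sqrt (2 * H * Real.Gamma (3 / 2 - H) / (Real.Gamma (H + 1 / 2) * Real.Gamma (2 - 2 * H)))

/-- The transfer operator `Γ_H^{(n)}`. -/
noncomputable def transfer (H : ℝ) {n : ℕ} (f : (Fin n → ℝ) → ℝ) (t : Fin n → ℝ) : ℝ :=
  (cH H * Real.Gamma (H + 1 / 2)) ^ n * (∏ j, t j ^ (1 / 2 - H)) *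
    fracIntegral (H - 1 / 2) 1 (fun x => f x * ∏ j, x j ^ (H - 1 / 2)) t

/-- The multiple integral `I_n^H(f) = I_n(Γ_H^{(n)} f)` with respect to the fractional Brownian
motion with Hurst parameter `H`. -/
noncomputable def fractionalIntegral {Ω : Type*} [MeasurableSpace Ω] (W : unitInterval → Ω → ℝ)
    (P : Measure Ω) (H : ℝ) {n : ℕ} (f : (Fin n → ℝ) → ℝ) : Ω → ℝ :=
  multipleIntegral W P (transfer H f)

/-- `f_1 ⊗ ⋯ ⊗ f_n`. -/
def tensor {n : ℕ} (f : Fin n → ℝ → ℝ) (x : Fin n → ℝ) : ℝ := ∏ i, f i (x i)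

/-- A function of one real variable, seen as a function on `ℝ^1`. -/
def single (f : ℝ → ℝ) (x : Fin 1 → ℝ) : ℝ := f (x 0)

end FractionalChaos

/-!
The transfer operator turns the theorem into one about the multiple Wiener–Itô integral `I_n`, and
`I_n` of a tensor product is a Wick product of Gaussian variables.

*Transfer operator.* `Γ_H^{(1)}` is the integral operator with kernel
`K(t, u) = c t^{1/2-H} u^{H-1/2} (u - t)^{H-3/2}` on `t < u`. A Möbius change of variables reduces
`∫ K(t, u) K(t, v) dt` to Euler's beta integral, and the value of `c_H` is such that the result is
`ψ(u, v)` (`lintegral_kernel_mul`). By the Fubini theorem, `Γ_H^{(1)}` maps `|𝓗|` to `L²([0,1])` and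
`∫ Γf Γg = ⟨f, g⟩_𝓗` (`FiniteEnergy.integral_transferOne_mul`). Moreover
`Γ_H^{(n)} (f_1 ⊗ ⋯ ⊗ f_n)` is the tensor product of the `Γ_H^{(1)} f_i` (`transfer_tensor`).

*Multiple integral.* The Wiener process gives an isometry `g ↦ W(g)` from `L²([0,1])` to `L²(P)`
whose values are jointly Gaussian. The Wick product `:W(g_1) ⋯ W(g_n):` arises from `1` by applying
the creation operators `X_i - ∑ j, C i j ∂_j`, which by Gaussian integration by parts are adjoint to
the derivations `∑ j, C i j ∂_j`. Hence the inner product of two Wick products is the permanent of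
the mutual covariances (`wick_mul_wick`), so that `g_1 ⊗ ⋯ ⊗ g_n ↦ :W(g_1) ⋯ W(g_n):` extends to a
bounded operator on `L²([0,1]^n)` of norm at most `√n!`. For indicators of disjoint sets the Wick
product is the ordinary product, so this operator integrates elementary functions correctly; since
these are dense (the diagonals are null sets), it is `I_n`
(`IsWienerProcess.multipleIntegral_prod`).

*Pairings.* The Wick product is the image of the monomial `X_1 ⋯ X_n` under `exp (-Δ / 2)`, where
`Δ = ∑ i j, C i j ∂_i ∂_j` (`wick_eq_sum_covLaplacian`). The `l`-th term of the exponential series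
is `(-1)^l / (2^l l!)` times a sum over tuples of `2 l` indices, of which only those with distinct
entries contribute; this is the asserted formula (`wick_ofFn_id`).
-/

namespace FractionalChaos

/-! ### Wick polynomials -/

section Wick

open MvPolynomial

variable {ι : Type*} (C : ι → ι → ℝ)

/-- The directional derivative `∑ j, C i j ∂_j` on polynomials, where `C` is thought of as the
covariance of the family of Gaussian variables represented by the indeterminates. -/
noncomputable def covDeriv (i : ι) : Derivation ℝ (MvPolynomial ι ℝ) (MvPolynomial ι ℝ) :=
  mkDerivation ℝ fun j => MvPolynomial.C (C i j)

/-- The Wick product `:X_{i_1} ⋯ X_{i_n}:` as a polynomial, obtained by applying the creation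
operators `X_i - ∑ j, C i j ∂_j` to `1`. -/
noncomputable def wick : List ι → MvPolynomial ι ℝ
  | [] => 1
  | i :: L => X i * wick L - covDeriv C i (wick L)

@[simp] lemma covDeriv_X (i j : ι) : covDeriv C i (X j) = MvPolynomial.C (C i j) := by
  simp [covDeriv, mkDerivation_X]

lemma covDeriv_comm (i j : ι) (p : MvPolynomial ι ℝ) :
    covDeriv C i (covDeriv C j p) = covDeriv C j (covDeriv C i p) := by
  have h : ⁅covDeriv C i, covDeriv C j⁆ = 0 := by
    apply MvPolynomial.derivation_ext
    intro k
    simp [Derivation.commutator_apply]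
  have := congrArg (fun D => D p) h
  simpa [Derivation.commutator_apply, sub_eq_zero] using this

/-- The annihilation operator `covDeriv C i` removes one factor of a Wick product at a time. -/
lemma covDeriv_wick (i : ι) {n : ℕ} (v : Fin (n + 1) → ι) :
    covDeriv C i (wick C (List.ofFn v)) =
      ∑ k, MvPolynomial.C (C i (v k)) * wick C (List.ofFn (v ∘ k.succAbove)) := by
  induction n with
  | zero => simp [List.ofFn_succ, wick]
  | succ n ih =>
    rw [List.ofFn_succ, wick, map_sub, Derivation.leibniz, covDeriv_comm, Fin.sum_univ_succ]
    have h1 : ∀ k : Fin (n + 1), wick C (List.ofFn (v ∘ k.succ.succAbove)) =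
        X (v 0) * wick C (List.ofFn ((fun i : Fin (n + 1) => v i.succ) ∘ k.succAbove)) -
          covDeriv C (v 0)
            (wick C (List.ofFn ((fun i : Fin (n + 1) => v i.succ) ∘ k.succAbove))) := by
      intro k
      rw [List.ofFn_succ, wick]
      simp [Function.comp_def]
    simp only [h1, ih, map_sum, Derivation.leibniz, smul_eq_mul, covDeriv_X, derivation_C, mul_sub,
      Finset.sum_sub_distrib, Finset.mul_sum, mul_zero, add_zero]
    have h2 : v ∘ (0 : Fin (n + 2)).succAbove = fun i : Fin (n + 1) => v i.succ := by
      ext; simp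
    rw [h2, add_comm, mul_comm (wick _ _), add_sub_assoc]
    congr 2
    exact Finset.sum_congr rfl fun k _ => by ring

/-- Wick products of length `n` pair to the permanent of their mutual covariances, with respect
to every functional satisfying the Gaussian integration by parts formula. -/
lemma wick_mul_wick (E : MvPolynomial ι ℝ →ₗ[ℝ] ℝ) (h1 : E 1 = 1)
    (hE : ∀ i p, E (X i * p) = E (covDeriv C i p)) {n : ℕ} (u v : Fin n → ι) :
    E (wick C (List.ofFn u) * wick C (List.ofFn v)) =
      ∑ σ : Equiv.Perm (Fin n), ∏ i, C (u i) (v (σ i)) := by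
  induction n with
  | zero => simp [wick, h1]
  | succ n ih =>
    have hadj : ∀ i p q, E ((X i * p - covDeriv C i p) * q) = E (p * covDeriv C i q) := by
      intro i p q
      have := hE i (p * q)
      rw [Derivation.leibniz, map_add, smul_eq_mul, smul_eq_mul] at this
      rw [sub_mul, map_sub, mul_assoc, this, mul_comm q]
      ring
    rw [List.ofFn_succ, wick, hadj, covDeriv_wick, Finset.mul_sum, map_sum,
      ← Equiv.Perm.decomposeFin.symm.sum_comp, Fintype.sum_prod_type]
    refine Finset.sum_congr rfl fun k _ => ?_
    rw [mul_left_comm, ← MvPolynomial.smul_eq_C_mul, map_smul, ih, smul_eq_mul, Finset.mul_sum]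
    simp only [Fin.prod_univ_succ, Equiv.Perm.decomposeFin_symm_apply_zero,
      Equiv.Perm.decomposeFin_symm_apply_succ]
    -- `swap 0 k ∘ succ` and `k.succAbove` differ by a permutation, over which the sum is invariant
    obtain ⟨ρ, hρ⟩ : ∃ ρ : Equiv.Perm (Fin n), ∀ j, Equiv.swap 0 k j.succ = k.succAbove (ρ j) := by
      refine Fin.cases ⟨1, fun j => by simp⟩ (fun i => ⟨i.cycleRange, fun j => ?_⟩) k
      rw [Fin.succAbove_cycleRange]
    rw [← Equiv.sum_comp (Equiv.mulLeft ρ)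
      (fun τ : Equiv.Perm (Fin n) => C (u 0) (v k) * ∏ i : Fin n, C (u i.succ)
        ((v ∘ k.succAbove) (τ i)))]
    refine Finset.sum_congr rfl fun τ _ => ?_
    simp [hρ]

lemma covDeriv_wick_eq_zero (i : ι) (L : List ι) (h : ∀ j ∈ L, C i j = 0) :
    covDeriv C i (wick C L) = 0 := by
  induction L with
  | nil => simp [wick]
  | cons a L ih =>
    have h2 := ih fun j hj => h j (List.mem_cons_of_mem _ hj)
    simp [wick, covDeriv_comm C i a, h2, h a]

/-- For uncorrelated variables the Wick product is the ordinary product. -/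
lemma wick_eq_prod (L : List ι) (h : L.Pairwise fun i j => C i j = 0) :
    wick C L = (L.map X).prod := by
  induction L with
  | nil => simp [wick]
  | cons a L ih =>
    rw [List.pairwise_cons] at h
    rw [wick, covDeriv_wick_eq_zero C a L h.1, ih h.2]
    simp

lemma rename_wick {κ : Type*} (g : κ → ι) (L : List κ) :
    rename g (wick (fun i j => C (g i) (g j)) L) = wick C (L.map g) := by
  have hD : ∀ i p, covDeriv C (g i) (rename g p) =
      rename g (covDeriv (fun i j => C (g i) (g j)) i p) := by
    intro i p
    induction p using MvPolynomial.induction_on with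
    | C a => simp
    | add p q hp hq => simp [hp, hq]
    | mul_X p j hp => simp [hp]
  induction L with
  | nil => simp [wick]
  | cons a L ih => simp [wick, ← ih, hD]

end Wick

/-! ### Wick products as sums over pairings -/

section WickExplicit

open MvPolynomial

variable {ι : Type*} (C : ι → ι → ℝ)

lemma two_mul_val_lt {l : ℕ} (j : Fin l) : 2 * (j : ℕ) < 2 * l := by omega

lemma two_mul_val_add_one_lt {l : ℕ} (j : Fin l) : 2 * (j : ℕ) + 1 < 2 * l := by omega

lemma pderiv_prod_X [DecidableEq ι] (a : ι) (S : Finset ι) :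
    pderiv a (∏ u ∈ S, X u : MvPolynomial ι ℝ) = if a ∈ S then ∏ u ∈ S.erase a, X u else 0 := by
  have h : ∀ T : Finset ι, a ∉ T → pderiv a (∏ u ∈ T, X u : MvPolynomial ι ℝ) = 0 := by
    intro T hT
    induction T using Finset.induction_on with
    | empty => simp
    | insert b T hb ih =>
      rw [Finset.mem_insert, not_or] at hT
      rw [Finset.prod_insert hb, Derivation.leibniz, ih hT.2, pderiv_X_of_ne (Ne.symm hT.1)]
      simp
  split_ifs with ha
  · rw [← Finset.mul_prod_erase S _ ha, Derivation.leibniz, h _ (Finset.notMem_erase a S)]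
    simp
  · exact h S ha

/-- Iterated differentiation of a squarefree monomial: only tuples of distinct indices survive. -/
lemma foldr_pderiv_prod_X [DecidableEq ι] (L : List ι) (S : Finset ι) :
    L.foldr (fun a p => pderiv a p) (∏ u ∈ S, X u : MvPolynomial ι ℝ) =
      if L.Nodup ∧ ∀ a ∈ L, a ∈ S then ∏ u ∈ S with u ∉ L, X u else 0 := by
  induction L with
  | nil => simp
  | cons a L ih =>
    rw [List.foldr_cons, ih]
    split_ifs with h1 h2 h2
    · rw [pderiv_prod_X, if_pos]
      · congr 1; grind
      · grind
    · rw [pderiv_prod_X, if_neg]; grind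
    · grind
    · simp

lemma covDeriv_pderiv (i j : ι) (p : MvPolynomial ι ℝ) :
    covDeriv C i (pderiv j p) = pderiv j (covDeriv C i p) := by
  classical
  have h : ⁅covDeriv C i, (pderiv j : Derivation ℝ (MvPolynomial ι ℝ) _)⁆ = 0 := by
    apply MvPolynomial.derivation_ext
    intro k
    by_cases h : k = j
    · subst h; simp [Derivation.commutator_apply]
    · simp [Derivation.commutator_apply, pderiv_X_of_ne h]
  have := congrArg (fun D => D p) h
  simpa [Derivation.commutator_apply, sub_eq_zero] using this

variable [Fintype ι]

/-- The second-order operator `∑ i j, C i j ∂_i ∂_j`. -/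
noncomputable def covLaplacian : Module.End ℝ (MvPolynomial ι ℝ) :=
  ∑ i, ∑ j, C i j • ((pderiv i).toLinearMap ∘ₗ (pderiv j).toLinearMap)

lemma covLaplacian_apply (p : MvPolynomial ι ℝ) :
    covLaplacian C p = ∑ i, ∑ j, C i j • pderiv i (pderiv j p) := by
  simp [covLaplacian]

lemma covDeriv_apply (i : ι) (p : MvPolynomial ι ℝ) :
    covDeriv C i p = ∑ j, C i j • pderiv j p := by
  classical
  induction p using MvPolynomial.induction_on with
  | C a => simp
  | add p q hp hq => simp [hp, hq, Finset.sum_add_distrib]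
  | mul_X p k hp =>
    classical
    have h : ∑ j, C i j • (p * (Pi.single j 1 : ι → MvPolynomial ι ℝ) k) =
        p * MvPolynomial.C (C i k) := by
      rw [Finset.sum_eq_single k]
      · simp [MvPolynomial.smul_eq_C_mul, mul_comm]
      · intro b _ hb; simp [Pi.single_eq_of_ne hb.symm]
      · simp
    simp [hp, pderiv_X, Finset.sum_add_distrib, h, Finset.mul_sum]

lemma covLaplacian_X_mul (hC : ∀ i j, C i j = C j i) (i : ι) (p : MvPolynomial ι ℝ) :
    covLaplacian C (X i * p) = X i * covLaplacian C p + 2 * covDeriv C i p := by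
  have h1 : ∀ a, ∑ b, C a b • pderiv b (X i * p) = X i * covDeriv C a p + C a i • p := by
    intro a
    rw [← covDeriv_apply, Derivation.leibniz, covDeriv_X, smul_eq_mul, smul_eq_mul, mul_comm p,
      MvPolynomial.smul_eq_C_mul]
  have h2 : ∀ q, covLaplacian C q = ∑ a, pderiv a (covDeriv C a q) := by
    intro q
    simp only [covLaplacian_apply, covDeriv_apply, map_sum, Derivation.map_smul]
  rw [h2, h2]
  simp only [covDeriv_apply C _ (X i * p), h1, map_add, Derivation.map_smul, Finset.sum_add_distrib]
  have h3 : ∑ a, pderiv a (X i * covDeriv C a p) =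
      X i * ∑ a, pderiv a (covDeriv C a p) + covDeriv C i p := by
    classical
    simp only [Derivation.leibniz, smul_eq_mul, Finset.sum_add_distrib, Finset.mul_sum, pderiv_X]
    congr 1
    rw [Finset.sum_eq_single i]
    · simp
    · intro b _ hb; simp [Pi.single_eq_of_ne hb.symm]
    · simp
  rw [h3, two_mul, ← add_assoc]
  congr 1
  rw [covDeriv_apply]
  exact Finset.sum_congr rfl fun a _ => by rw [hC]

lemma covLaplacian_covDeriv (i : ι) (p : MvPolynomial ι ℝ) :
    covLaplacian C (covDeriv C i p) = covDeriv C i (covLaplacian C p) := by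
  simp only [covLaplacian_apply, map_sum, Derivation.map_smul, covDeriv_pderiv]

/-- The commutator of `Δ ^ (l + 1)` with multiplication by `X i` is `2 (l + 1) D_i Δ ^ l`, where
`D_i = covDeriv C i`. Hence conjugating `X i` by `exp (-Δ / 2)` gives the creation operator. -/
lemma covLaplacian_pow_X_mul (hC : ∀ i j, C i j = C j i) (i : ι) (l : ℕ) (p : MvPolynomial ι ℝ) :
    (covLaplacian C ^ (l + 1)) (X i * p) =
      X i * (covLaplacian C ^ (l + 1)) p +
        (2 * (l + 1) : ℝ) • covDeriv C i ((covLaplacian C ^ l) p) := by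
  induction l with
  | zero =>
    have h : (2 : MvPolynomial ι ℝ) = MvPolynomial.C 2 := (map_ofNat _ 2).symm
    simp [covLaplacian_X_mul C hC, MvPolynomial.smul_eq_C_mul, h]
  | succ l ih =>
    have h : ∀ m q, (covLaplacian C ^ (m + 1)) q = covLaplacian C ((covLaplacian C ^ m) q) := by
      intro m q
      rw [pow_succ', Module.End.mul_apply]
    have h2 : (2 : MvPolynomial ι ℝ) = MvPolynomial.C 2 := (map_ofNat _ 2).symm
    rw [h, ih, map_add, covLaplacian_X_mul C hC, map_smul, covLaplacian_covDeriv, ← h, ← h,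
      add_assoc, h2, ← MvPolynomial.smul_eq_C_mul, ← add_smul]
    congr 2
    push_cast
    ring

/-- Wick products are the image of ordinary products under `exp (-Δ / 2)`, where
`Δ = ∑ i j, C i j ∂_i ∂_j`. -/
lemma wick_eq_sum_covLaplacian (hC : ∀ i j, C i j = C j i) (L : List ι) (N : ℕ)
    (hN : L.length + 1 ≤ N) :
    wick C L = ∑ l ∈ Finset.range N, ((-1) ^ l / (2 ^ l * (l.factorial : ℝ))) •
      (covLaplacian C ^ l) (L.map X).prod := by
  induction L generalizing N with
  | nil =>
    obtain ⟨N, rfl⟩ : ∃ M, N = M + 1 := ⟨N - 1, by grind⟩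
    rw [Finset.sum_range_succ', Finset.sum_eq_zero]
    · simp [wick]
    · intro l _
      have h : (covLaplacian C ^ (l + 1)) (List.map X []).prod = 0 := by
        rw [pow_succ, Module.End.mul_apply, List.map_nil, List.prod_nil, covLaplacian_apply]
        simp
      rw [h, smul_zero]
  | cons a L ih =>
    obtain ⟨N, rfl⟩ : ∃ M, N = M + 1 := ⟨N - 1, by grind⟩
    simp only [List.length_cons, add_le_add_iff_right] at hN
    rw [wick]
    nth_rw 1 [ih (N + 1) (by omega)]
    rw [ih N hN, Finset.sum_range_succ', Finset.sum_range_succ']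
    have hc : ∀ l : ℕ, (-1 : ℝ) ^ (l + 1) / (2 ^ (l + 1) * ((l + 1).factorial : ℝ)) *
        (2 * (l + 1)) = -((-1) ^ l / (2 ^ l * (l.factorial : ℝ))) := by
      intro l
      rw [Nat.factorial_succ]
      have := Nat.factorial_pos l
      push_cast
      field_simp
      ring
    have ht : ∀ l : ℕ, ((-1 : ℝ) ^ (l + 1) / (2 ^ (l + 1) * ((l + 1).factorial : ℝ))) •
        (covLaplacian C ^ (l + 1)) ((a :: L).map X).prod =
          X a * (((-1 : ℝ) ^ (l + 1) / (2 ^ (l + 1) * ((l + 1).factorial : ℝ))) •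
            (covLaplacian C ^ (l + 1)) (L.map X).prod) -
          covDeriv C a (((-1) ^ l / (2 ^ l * (l.factorial : ℝ))) •
            (covLaplacian C ^ l) (L.map X).prod) := by
      intro l
      rw [List.map_cons, List.prod_cons, covLaplacian_pow_X_mul C hC, smul_add, smul_smul, hc,
        neg_smul, Derivation.map_smul, mul_smul_comm, sub_eq_add_neg]
    simp only [ht, mul_add, map_sum, Finset.sum_sub_distrib, Finset.mul_sum]
    simp
    abel

lemma covLaplacian_pow_apply (l : ℕ) (p : MvPolynomial ι ℝ) :
    (covLaplacian C ^ l) p =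
      ∑ k : Fin (2 * l) → ι, (∏ j : Fin l, C (k ⟨2 * (j : ℕ), two_mul_val_lt j⟩)
        (k ⟨2 * (j : ℕ) + 1, two_mul_val_add_one_lt j⟩)) •
          (List.ofFn k).foldr (fun a p => pderiv a p) p := by
  induction l with
  | zero => simp
  | succ l ih =>
    rw [pow_succ', Module.End.mul_apply, ih]
    have e : ∀ F : (Fin (2 * (l + 1)) → ι) → MvPolynomial ι ℝ, ∑ k, F k =
        ∑ a, ∑ b, ∑ k : Fin (2 * l) → ι, F (Fin.cons a (Fin.cons b k : Fin (2 * l + 1) → ι)) := by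
      intro F
      refine (Fintype.sum_equiv (Fin.consEquiv (n := 2 * l + 1) fun _ => ι)
        (fun q => F (Fin.cons q.1 q.2)) F fun _ => rfl).symm.trans ?_
      rw [Fintype.sum_prod_type]
      refine Finset.sum_congr rfl fun a _ => ?_
      refine (Fintype.sum_equiv (Fin.consEquiv (n := 2 * l) fun _ => ι)
        (fun q => F (Fin.cons a (Fin.cons q.1 q.2 : Fin (2 * l + 1) → ι))) _
        fun _ => rfl).symm.trans ?_
      rw [Fintype.sum_prod_type]
    rw [e, covLaplacian_apply]
    refine Finset.sum_congr rfl fun a _ => Finset.sum_congr rfl fun b _ => ?_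
    rw [map_sum, map_sum, Finset.smul_sum]
    refine Finset.sum_congr rfl fun k _ => ?_
    rw [Fin.prod_univ_succ, mul_smul, Derivation.map_smul, Derivation.map_smul]
    congr 1
    congr 1
    rw [List.ofFn_succ, List.foldr_cons, List.ofFn_succ, List.foldr_cons]
    rfl

/-- The explicit form of the Wick product of all indeterminates: a sum over partial pairings,
encoded by injections `k` of `{0, …, 2 l - 1}`, which pair `k (2 j)` with `k (2 j + 1)`. -/
lemma wick_ofFn_id {n : ℕ} (C : Fin n → Fin n → ℝ) (hC : ∀ i j, C i j = C j i) :
    wick C (List.ofFn id) = ∏ i, X i +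
      ∑ l ∈ Finset.Icc 1 (n / 2), ((-1) ^ l / (2 ^ l * (l.factorial : ℝ))) •
        ∑ k : Fin (2 * l) ↪ Fin n, (∏ j : Fin l, C (k ⟨2 * (j : ℕ), two_mul_val_lt j⟩)
          (k ⟨2 * (j : ℕ) + 1, two_mul_val_add_one_lt j⟩)) • ∏ u with ∀ m, k m ≠ u, X u := by
  have h1 : ∀ l : ℕ, (covLaplacian C ^ l) ((List.ofFn id).map X).prod =
      ∑ k : Fin (2 * l) ↪ Fin n, (∏ j : Fin l, C (k ⟨2 * (j : ℕ), two_mul_val_lt j⟩)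
          (k ⟨2 * (j : ℕ) + 1, two_mul_val_add_one_lt j⟩)) • ∏ u with ∀ m, k m ≠ u, X u := by
    intro l
    rw [covLaplacian_pow_apply, List.map_ofFn, List.prod_ofFn]
    simp only [Function.comp_id]
    simp_rw [foldr_pderiv_prod_X]
    rw [← Finset.sum_subset (Finset.subset_univ (Finset.univ.filter Function.Injective)),
      ← Finset.sum_subtype_eq_sum_filter, Finset.subtype_univ,
      ← (Equiv.subtypeInjectiveEquivEmbedding (Fin (2 * l)) (Fin n)).symm.sum_comp]
    · refine Finset.sum_congr rfl fun k _ => ?_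
      rw [if_pos]
      · congr 1
        refine Finset.prod_congr ?_ fun _ _ => rfl
        ext u
        simp [List.mem_ofFn, Equiv.subtypeInjectiveEquivEmbedding]
      · simpa [List.nodup_ofFn, Equiv.subtypeInjectiveEquivEmbedding] using k.injective
    · intro k _ hk
      rw [if_neg, smul_zero]
      simpa [List.nodup_ofFn] using hk
  rw [wick_eq_sum_covLaplacian C hC _ (n + 1) (by simp), Finset.sum_range_succ']
  simp only [h1]
  rw [add_comm]
  congr 1
  · simp
  · rw [Finset.range_eq_Ico, Finset.sum_Ico_add' (fun l : ℕ => ((-1 : ℝ) ^ l /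
      (2 ^ l * (l.factorial : ℝ))) • ∑ k : Fin (2 * l) ↪ Fin n, (∏ j : Fin l,
        C (k ⟨2 * (j : ℕ), two_mul_val_lt j⟩) (k ⟨2 * (j : ℕ) + 1, two_mul_val_add_one_lt j⟩)) •
          (∏ u with ∀ m, k m ≠ u, X u : MvPolynomial (Fin n) ℝ)) 0 n 1]
    refine (Finset.sum_subset (fun l => by simp; omega) fun l hl1 hl2 => ?_).symm
    -- there are no injections of a set of more than `n` elements
    have : IsEmpty (Fin (2 * l) ↪ Fin n) := by
      rw [← not_nonempty_iff, Function.Embedding.nonempty_iff_card_le]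
      simp at hl1 hl2 ⊢
      omega
    simp

end WickExplicit

/-! ### Gaussian integration by parts -/

section Gaussian

open scoped ENNReal

variable {Ω : Type*} [MeasurableSpace Ω] {P : Measure Ω} {ι : Type*}

/-- Polynomials in variables with moments of all orders have moments of all orders. -/
lemma memLp_eval_mvPolynomial [IsFiniteMeasure P] {X : ι → Ω → ℝ}
    (hX : ∀ i, ∀ r : ℝ≥0∞, r ≠ ∞ → MemLp (X i) r P) (p : MvPolynomial ι ℝ) :
    ∀ r : ℝ≥0∞, r ≠ ∞ → MemLp (fun ω => p.eval fun i => X i ω) r P := by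
  induction p using MvPolynomial.induction_on with
  | C a => intro r _; simpa using memLp_const a
  | add p q hp hq => intro r hr; simpa using! (hp r hr).add (hq r hr)
  | mul_X p i hp =>
    intro r hr
    have : ENNReal.HolderTriple (2 * r) (2 * r) r := by
      constructor
      rw [ENNReal.mul_inv (by simp) (by simp), ← add_mul, ENNReal.inv_two_add_inv_two, one_mul]
    have h2 : 2 * r ≠ ∞ := ENNReal.mul_ne_top (by simp) hr
    simpa using (hX i _ h2).mul' (r := r) (hp _ h2)

lemma measurable_eval_mvPolynomial {α : Type*} [MeasurableSpace α] {X : ι → α → ℝ}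
    (hX : ∀ i, Measurable (X i)) (p : MvPolynomial ι ℝ) :
    Measurable fun ω => p.eval fun i => X i ω := by
  simp only [MvPolynomial.eval_eq]
  fun_prop

lemma integrable_eval_gaussianReal (v : NNReal) (q : Polynomial ℝ) :
    Integrable (fun x => q.eval x) (gaussianReal 0 v) := by
  have h := memLp_eval_mvPolynomial (P := gaussianReal 0 v) (X := fun (_ : Unit) x => x)
    (fun _ r hr => by simpa using! IsGaussian.memLp_id (gaussianReal 0 v) r hr)
    (Polynomial.aeval (MvPolynomial.X ()) q) 1 (by simp)
  rw [memLp_one_iff_integrable] at h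
  convert! h using 2 with x
  have := Polynomial.hom_eval₂ q (algebraMap ℝ (MvPolynomial Unit ℝ))
    (MvPolynomial.eval fun _ => x) (MvPolynomial.X ())
  rw [Polynomial.aeval_def, this, MvPolynomial.eval_X]
  simp [Polynomial.eval, Polynomial.eval₂_eq_sum]

/-- Integration by parts against a centred Gaussian measure on the line. -/
lemma integral_mul_eval_gaussianReal (v : NNReal) (q : Polynomial ℝ) :
    ∫ x, x * q.eval x ∂(gaussianReal 0 v) = v * ∫ x, q.derivative.eval x ∂(gaussianReal 0 v) := by
  by_cases hv : v = 0
  · simp [hv]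
  have hd : ∀ x, HasDerivAt (fun x => gaussianPDFReal 0 v x * q.eval x)
      (gaussianPDFReal 0 v x * (q.derivative.eval x - (v : ℝ)⁻¹ * (x * q.eval x))) x := by
    intro x
    have h1 : HasDerivAt (gaussianPDFReal 0 v) (gaussianPDFReal 0 v x * (-(v : ℝ)⁻¹ * x)) x := by
      have h2 : HasDerivAt (fun x : ℝ => -(x - 0) ^ 2 / (2 * (v : ℝ))) (-(v : ℝ)⁻¹ * x) x := by
        have h3 := (((hasDerivAt_id x).sub_const 0).pow 2).neg.div_const (2 * (v : ℝ))
        have hv' : (v : ℝ) ≠ 0 := by simpa using hv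
        convert! h3 using 1
        simp
        field_simp
      rw [gaussianPDFReal_def]
      convert! (h2.exp.const_mul _) using 1
      ring
    convert! h1.mul (q.hasDerivAt x) using 1
    ring
  have hint : ∀ q : Polynomial ℝ, Integrable (fun x => gaussianPDFReal 0 v x * q.eval x) := by
    intro q
    have h := integrable_eval_gaussianReal v q
    rw [gaussianReal_of_var_ne_zero _ hv, integrable_withDensity_iff_integrable_smul'
      (measurable_gaussianPDF 0 v) (by simp [gaussianPDF])] at h
    simpa using h
  have h0 := integral_eq_zero_of_hasDerivAt_of_integrable hd (by
    convert! hint (q.derivative - Polynomial.C (v : ℝ)⁻¹ * (Polynomial.X * q)) using 3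
    simp) (hint q)
  simp only [← smul_eq_mul (gaussianPDFReal 0 v _)] at h0
  rw [← integral_gaussianReal_eq_integral_smul hv (f := fun x => q.derivative.eval x -
    (v : ℝ)⁻¹ * (x * q.eval x)), integral_sub (integrable_eval_gaussianReal v _),
    integral_const_mul, sub_eq_zero] at h0
  · rw [h0]
    have hv' : (v : ℝ) ≠ 0 := by simpa using hv
    field_simp
  · have := integrable_eval_gaussianReal v (Polynomial.X * q)
    simp only [Polynomial.eval_mul, Polynomial.eval_X] at this
    exact this.const_mul _

/-- Gaussian integration by parts: `E[X_i p(X)] = ∑ j, E[X_i X_j] E[∂_j p(X)]` for a centred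
Gaussian process `X` and a polynomial `p`. The reason is that `X_j` is the sum of a multiple of
`X_i` and a variable that is independent of `X_i`, so that the one-dimensional formula applies. -/
lemma integral_mul_eval_gaussianProcess [IsProbabilityMeasure P] {X : ι → Ω → ℝ}
    (hX : IsGaussianProcess X P)
    (hm : ∀ i, Measurable (X i)) (h0 : ∀ i, ∫ ω, X i ω ∂P = 0) (i : ι) (p : MvPolynomial ι ℝ) :
    ∫ ω, (MvPolynomial.X i * p).eval (fun j => X j ω) ∂P =
      ∫ ω, (covDeriv (fun i j => ∫ ω, X i ω * X j ω ∂P) i p).eval (fun j => X j ω) ∂P := by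
  set C : ι → ι → ℝ := fun i j => ∫ ω, X i ω * X j ω ∂P with hC
  have hL : ∀ j, ∀ r : ℝ≥0∞, r ≠ ∞ → MemLp (X j) r P :=
    fun j r hr => (hX.hasGaussianLaw_eval j).memLp hr
  have hcov : ∀ j k, cov[X j, X k; P] = C j k := by
    intro j k
    rw [covariance_eq_sub (hL j 2 (by simp)) (hL k 2 (by simp)), h0 j]
    simp [hC]
  obtain ⟨a, ha⟩ : ∃ a : ι → ℝ, ∀ j, a j * C i i = C i j := by
    by_cases hv : C i i = 0
    · refine ⟨0, fun j => ?_⟩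
      have h1 : (fun ω => X i ω * X i ω) =ᵐ[P] 0 :=
        (integral_eq_zero_iff_of_nonneg (fun ω => mul_self_nonneg _)
          ((hL i 2 (by simp)).integrable_mul (hL i 2 (by simp)))).1 hv
      have h2 : (fun ω => X i ω * X j ω) =ᵐ[P] 0 := by
        filter_upwards [h1] with ω h
        simp [mul_self_eq_zero.1 h]
      simp [hC, integral_congr_ae h2]
    · exact ⟨fun j => C i j / C i i, fun j => div_mul_cancel₀ _ hv⟩
  let R : ι → Ω → ℝ := fun j ω => X j ω - a j * X i ω
  have hR : ∀ j, Measurable (R j) := fun j => (hm j).sub ((hm i).const_mul _)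
  have hG : IsGaussianProcess (Sum.elim (fun _ : Unit => X i) R) P := by
    classical
    refine hX.of_isGaussianProcess fun s => ?_
    rcases s with s | j
    · exact ⟨{i}, ContinuousLinearMap.proj ⟨i, by simp⟩, fun ω => by simp⟩
    · exact ⟨{i, j}, ContinuousLinearMap.proj ⟨j, by simp⟩ -
        a j • ContinuousLinearMap.proj ⟨i, by simp⟩, fun ω => by simp [R]⟩
  have hind := hG.indepFun_of_covariance_eq_zero (fun _ => (hm i).aemeasurable)
    (fun j => (hR j).aemeasurable) (fun _ j => by
      have : R j = X j - (fun ω => a j * X i ω) := rfl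
      rw [this, covariance_sub_right (hL i 2 (by simp)) (hL j 2 (by simp))
        ((hL i 2 (by simp)).const_mul _), covariance_const_mul_right, hcov, hcov, ha, sub_self])
  have hind' : IndepFun (X i) (fun ω j => R j ω) P :=
    hind.comp (φ := fun f : Unit → ℝ => f ()) (measurable_pi_apply ()) measurable_id
  have hRm : Measurable fun ω j => R j ω := measurable_pi_iff.2 hR
  rw [indepFun_iff_map_prod_eq_prod_map_map (hm i).aemeasurable hRm.aemeasurable] at hind'
  have hlaw : P.map (X i) = gaussianReal 0 (C i i).toNNReal := by
    rw [(hX.hasGaussianLaw_eval i).map_eq_gaussianReal, h0 i,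
      ← covariance_self (hm i).aemeasurable, hcov]
  have hCi : 0 ≤ C i i := integral_nonneg fun ω => mul_self_nonneg _
  have hRp : IsProbabilityMeasure (P.map fun ω j => R j ω) :=
    Measure.isProbabilityMeasure_map hRm.aemeasurable
  have hXp : IsProbabilityMeasure (P.map (X i)) :=
    Measure.isProbabilityMeasure_map (hm i).aemeasurable
  -- by independence, expectations of functions of `(X i, R)` are iterated integrals
  have key : ∀ F : ℝ × (ι → ℝ) → ℝ, Measurable F →
      Integrable (fun ω => F (X i ω, fun j => R j ω)) P →
      ∫ ω, F (X i ω, fun j => R j ω) ∂P =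
        ∫ r, ∫ x, F (x, r) ∂(gaussianReal 0 (C i i).toNNReal) ∂(P.map fun ω j => R j ω) := by
    intro F hF hint
    have hint' : Integrable F ((P.map (X i)).prod (P.map fun ω j => R j ω)) := by
      rw [← hind', integrable_map_measure hF.aestronglyMeasurable
        ((hm i).prodMk hRm).aemeasurable]
      exact hint
    rw [← hlaw, ← integral_prod_symm _ hint', ← hind', integral_map
      ((hm i).prodMk hRm).aemeasurable hF.aestronglyMeasurable]
  have hq : ∀ q : MvPolynomial ι ℝ,
      Measurable fun y : ℝ × (ι → ℝ) => q.eval (fun j => a j * y.1 + y.2 j) := fun q =>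
    measurable_eval_mvPolynomial (X := fun j (y : ℝ × (ι → ℝ)) => a j * y.1 + y.2 j)
      (fun j => by fun_prop) q
  have hXR : ∀ ω, (fun j => a j * X i ω + R j ω) = fun j => X j ω := by
    intro ω
    ext j
    simp [R]
  have hint : ∀ q : MvPolynomial ι ℝ, Integrable (fun ω => q.eval fun j => X j ω) P := fun q =>
    memLp_one_iff_integrable.1 (memLp_eval_mvPolynomial hL q 1 (by simp))
  have k1 := key (fun y => y.1 * p.eval (fun j => a j * y.1 + y.2 j))
    (measurable_fst.mul (hq p)) (by
      have h := hint (MvPolynomial.X i * p)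
      simp only [map_mul, MvPolynomial.eval_X] at h
      simpa only [hXR] using h)
  have k2 := key (fun y => (covDeriv C i p).eval (fun j => a j * y.1 + y.2 j)) (hq _)
    (by simpa only [hXR] using hint (covDeriv C i p))
  simp only [hXR] at k1 k2
  simp only [map_mul, MvPolynomial.eval_X]
  rw [k1, k2]
  refine integral_congr_ae (.of_forall fun r => ?_)
  -- for fixed `r`, the integrand is a polynomial in `x`
  let Q : MvPolynomial ι ℝ →ₐ[ℝ] Polynomial ℝ :=
    MvPolynomial.aeval fun j => Polynomial.C (a j) * Polynomial.X + Polynomial.C (r j)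
  have hQ : ∀ (q : MvPolynomial ι ℝ) x, (Q q).eval x = q.eval fun j => a j * x + r j := by
    intro q x
    induction q using MvPolynomial.induction_on with
    | C b => simp [Q]
    | add p q hp hq => simp [hp, hq]
    | mul_X p j hp => simp [hp, Q]
  have hQd : ∀ q : MvPolynomial ι ℝ,
      Q (covDeriv C i q) = Polynomial.C (C i i) * (Q q).derivative := by
    intro q
    induction q using MvPolynomial.induction_on with
    | C b => simp [Q]
    | add p q hp hq => simp [hp, hq, mul_add]
    | mul_X p j hp =>
      have h1 : Q (MvPolynomial.X j) = Polynomial.C (a j) * Polynomial.X + Polynomial.C (r j) := by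
        simp [Q]
      have h2 : Q (MvPolynomial.C (C i j)) = Polynomial.C (a j) * Polynomial.C (C i i) := by
        rw [← map_mul, ha]
        simp [Q]
      simp only [Derivation.leibniz, covDeriv_X, smul_eq_mul, map_add, map_mul, hp, h1, h2,
        Polynomial.derivative_mul, Polynomial.derivative_C, Polynomial.derivative_X]
      ring
  simp only [← hQ, hQd, Polynomial.eval_mul, Polynomial.eval_C]
  rw [integral_mul_eval_gaussianReal, integral_const_mul, Real.coe_toNNReal _ hCi]

end Gaussian

/-! ### The Wiener integral as an isometry -/

section LpTools

variable {α β : Type*} [MeasurableSpace α] [MeasurableSpace β] {μ : Measure α} {ν : Measure β}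

lemma coeFn_linearCombination {κ : Type*} {f : κ → α → ℝ} (hf : ∀ a, MemLp (f a) 2 μ)
    (m : κ →₀ ℝ) :
    (Finsupp.linearCombination ℝ (fun a => (hf a).toLp (f a)) m : α → ℝ) =ᵐ[μ]
      fun x => m.sum fun a c => c * f a x := by
  induction m using Finsupp.induction_linear with
  | zero => simpa using! Lp.coeFn_zero ℝ 2 μ
  | add m₁ m₂ h₁ h₂ =>
    rw [map_add]
    filter_upwards [h₁, h₂, Lp.coeFn_add (Finsupp.linearCombination ℝ
      (fun a => (hf a).toLp (f a)) m₁) (Finsupp.linearCombination ℝ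
      (fun a => (hf a).toLp (f a)) m₂)] with x e₁ e₂ e₃
    rw [e₃, Pi.add_apply, e₁, e₂, Finsupp.sum_add_index'] <;> simp [add_mul]
  | single a c =>
    rw [Finsupp.linearCombination_single]
    filter_upwards [Lp.coeFn_smul c ((hf a).toLp (f a)), (hf a).coeFn_toLp] with x e₁ e₂
    rw [e₁, Pi.smul_apply, e₂]
    simp

lemma inner_linearCombination {κ E : Type*} [NormedAddCommGroup E] [InnerProductSpace ℝ E]
    (u : κ → E) (m : κ →₀ ℝ) (x : E) :
    inner ℝ (Finsupp.linearCombination ℝ u m) x = m.sum fun a c => c * inner ℝ (u a) x := by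
  rw [Finsupp.linearCombination_apply, Finsupp.sum_inner]
  simp [inner_smul_left]

lemma norm_linearCombination_sq {κ E : Type*} [NormedAddCommGroup E] [InnerProductSpace ℝ E]
    (u : κ → E) (m : κ →₀ ℝ) :
    ‖Finsupp.linearCombination ℝ u m‖ ^ 2 =
      m.sum fun a c => m.sum fun b d => c * (d * inner ℝ (u b) (u a)) := by
  rw [← real_inner_self_eq_norm_sq, inner_linearCombination]
  refine Finsupp.sum_congr fun a _ => ?_
  rw [real_inner_comm, inner_linearCombination, Finsupp.mul_sum]

/-- If `F_k → f` and `T F_k → X` in `L²` for a continuous operator `T`, then `X = T f`. -/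
lemma ae_eq_of_tendsto_eLpNorm (T : Lp ℝ 2 μ →L[ℝ] Lp ℝ 2 ν) {f : α → ℝ} (hf : MemLp f 2 μ)
    {X : β → ℝ} (hX : MemLp X 2 ν) {F : ℕ → α → ℝ} (hF : ∀ k, MemLp (F k) 2 μ)
    {Y : ℕ → β → ℝ} (hY : ∀ k, Y k =ᵐ[ν] T ((hF k).toLp (F k)))
    (h1 : Tendsto (fun k => eLpNorm (fun x => f x - F k x) 2 μ) atTop (𝓝 0))
    (h2 : Tendsto (fun k => eLpNorm (fun x => X x - Y k x) 2 ν) atTop (𝓝 0)) :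
    X =ᵐ[ν] T (hf.toLp f) := by
  have hY2 : ∀ k, MemLp (Y k) 2 ν := fun k => (Lp.memLp _).ae_eq (hY k).symm
  have t1 : Tendsto (fun k => (hF k).toLp (F k)) atTop (𝓝 (hf.toLp f)) := by
    rw [Lp.tendsto_Lp_iff_tendsto_eLpNorm'']
    refine h1.congr fun k => ?_
    rw [eLpNorm_sub_comm]
    rfl
  have t2 : Tendsto (fun k => (hY2 k).toLp (Y k)) atTop (𝓝 (hX.toLp X)) := by
    rw [Lp.tendsto_Lp_iff_tendsto_eLpNorm'']
    refine h2.congr fun k => ?_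
    rw [eLpNorm_sub_comm]
    rfl
  have e : ∀ k, (hY2 k).toLp (Y k) = T ((hF k).toLp (F k)) := by
    intro k
    ext1
    exact (hY2 k).coeFn_toLp.trans (hY k)
  simp only [e] at t2
  rw [← tendsto_nhds_unique t2 ((T.continuous.tendsto _).comp t1)]
  exact hX.coeFn_toLp.symm

/-- If `F_k → f` in `L²`, then `T F_k → T f` in `L²` for a continuous operator `T`. -/
lemma tendsto_eLpNorm_of_tendsto (T : Lp ℝ 2 μ →L[ℝ] Lp ℝ 2 ν) {f : α → ℝ} (hf : MemLp f 2 μ)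
    {F : ℕ → α → ℝ} (hF : ∀ k, MemLp (F k) 2 μ)
    {Y : ℕ → β → ℝ} (hY : ∀ k, Y k =ᵐ[ν] T ((hF k).toLp (F k)))
    (h1 : Tendsto (fun k => eLpNorm (fun x => f x - F k x) 2 μ) atTop (𝓝 0)) :
    Tendsto (fun k => eLpNorm (fun x => T (hf.toLp f) x - Y k x) 2 ν) atTop (𝓝 0) := by
  have t1 : Tendsto (fun k => (hF k).toLp (F k)) atTop (𝓝 (hf.toLp f)) := by
    rw [Lp.tendsto_Lp_iff_tendsto_eLpNorm'']
    refine h1.congr fun k => ?_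
    rw [eLpNorm_sub_comm]
    rfl
  have t2 := (T.continuous.tendsto _).comp t1
  rw [Lp.tendsto_Lp_iff_tendsto_eLpNorm'] at t2
  refine t2.congr fun k => ?_
  rw [eLpNorm_sub_comm]
  refine eLpNorm_congr_ae ?_
  filter_upwards [hY k] with x hx
  simp [hx]

end LpTools

/-- Lebesgue measure on `[0,1]`. -/
noncomputable abbrev lebI : Measure ℝ := (volume : Measure ℝ).restrict (Set.Icc 0 1)

/-- The class of `1_{(0, t]}` in `L²([0,1])`. -/
noncomputable def ramp (t : unitInterval) : Lp ℝ 2 lebI :=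
  indicatorConstLp 2 (measurableSet_Ioc (a := (0 : ℝ)) (b := (t : ℝ)))
    (measure_ne_top _ _) (1 : ℝ)

lemma inner_ramp (s t : unitInterval) : inner ℝ (ramp s) (ramp t) = min (s : ℝ) t := by
  have h : Set.Ioc (0 : ℝ) s ∩ Set.Ioc 0 t ∩ Set.Icc 0 1 = Set.Ioc 0 (min (s : ℝ) t) := by
    ext x
    have := s.2.2
    simp only [Set.mem_inter_iff, Set.mem_Ioc, Set.mem_Icc, le_min_iff]
    constructor
    · rintro ⟨⟨h1, h2⟩, -⟩
      exact ⟨h1.1, h1.2, h2.2⟩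
    · rintro ⟨h1, h2, h3⟩
      exact ⟨⟨⟨h1, h2⟩, h1, h3⟩, h1.le, h2.trans this⟩
  rw [ramp, ramp, L2.inner_indicatorConstLp_indicatorConstLp, measureReal_def,
    Measure.restrict_apply (measurableSet_Ioc.inter measurableSet_Ioc), h, Real.volume_Ioc,
    sub_zero, ENNReal.toReal_ofReal (le_min s.2.1 t.2.1)]
  simp

lemma ae_eq_zero_of_forall_setIntegral_Iic {μ : Measure ℝ} {f : ℝ → ℝ} (hf : Integrable f μ)
    (h0 : ∫ x, f x ∂μ = 0) (h : ∀ t, ∫ x in Set.Iic t, f x ∂μ = 0) : f =ᵐ[μ] 0 := by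
  have key : ∀ s, MeasurableSet s → ∫ x in s, f x ∂μ = 0 := by
    intro s hs
    induction s, hs using MeasurableSpace.induction_on_inter
      ((BorelSpace.measurable_eq (α := ℝ)).trans (borel_eq_generateFrom_Iic ℝ))
      isPiSystem_Iic with
    | empty => simp
    | basic s hs => obtain ⟨t, rfl⟩ := hs; exact h t
    | compl s hs ih => rw [setIntegral_compl hs hf, h0, ih, sub_zero]
    | iUnion g hd hg ih =>
      have := hasSum_integral_iUnion hg hd hf.integrableOn
      simp only [ih] at this
      exact this.unique hasSum_zero
  exact hf.ae_eq_zero_of_forall_setIntegral_eq_zero fun s hs _ => key s hs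

/-- A function orthogonal to all `1_{(0, t]}` has vanishing integrals over half-lines, hence is
null. -/
lemma denseRange_linearCombination_ramp :
    DenseRange (Finsupp.linearCombination ℝ ramp) := by
  have h : (Submodule.span ℝ (Set.range ramp))ᗮ = ⊥ := by
    rw [Submodule.eq_bot_iff]
    intro f hf
    have h1 : ∀ t : unitInterval, ∫ x in Set.Ioc 0 (t : ℝ), f x ∂lebI = 0 := by
      intro t
      rw [← L2.inner_indicatorConstLp_one measurableSet_Ioc (measure_ne_top _ _)]
      exact (Submodule.mem_orthogonal _ _).1 hf (ramp t) (Submodule.subset_span ⟨t, rfl⟩)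
    have hfi : Integrable f lebI := (Lp.memLp f).integrable (by norm_num)
    have h2 : ∀ t : ℝ, ∫ x in Set.Iic t, f x ∂lebI = 0 := by
      intro t
      rw [← h1 (Set.projIcc 0 1 zero_le_one t), Measure.restrict_restrict measurableSet_Iic,
        Measure.restrict_restrict measurableSet_Ioc]
      refine setIntegral_congr_set ?_
      have h3 : ∀ᵐ x : ℝ, x ≠ 0 := by simp [ae_iff]
      filter_upwards [h3] with x hx
      simp only [eq_iff_iff]
      change (x ≤ t ∧ 0 ≤ x ∧ x ≤ 1) ↔ ((0 < x ∧ x ≤ _) ∧ 0 ≤ x ∧ x ≤ 1)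
      rw [Set.coe_projIcc]
      grind
    have h3 : f =ᵐ[lebI] 0 := by
      refine ae_eq_zero_of_forall_setIntegral_Iic hfi ?_ h2
      have := h2 1
      rw [Measure.restrict_restrict measurableSet_Iic,
        Set.inter_eq_right.2 (fun x hx => hx.2)] at this
      exact this
    exact (Lp.eq_zero_iff_ae_eq_zero).2 h3
  rw [← Submodule.topologicalClosure_eq_top_iff] at h
  rw [DenseRange, ← LinearMap.coe_range, Finsupp.range_linearCombination]
  exact Submodule.dense_iff_topologicalClosure_eq_top.2 h

section Wiener

variable {Ω : Type*} [MeasurableSpace Ω] {P : Measure Ω}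
  {W : unitInterval → Ω → ℝ}

namespace IsWienerProcess

/-- The values `W_t` are jointly Gaussian, being sums of independent Gaussian increments. -/
lemma isGaussianProcess (hW : IsWienerProcess W P) : IsGaussianProcess W P := by
  refine hW.indep.isGaussianProcess (fun t => ?_) hW.zero
  refine (hW.law 0 t bot_le).hasGaussianLaw.congr ?_
  filter_upwards [hW.zero] with ω h
  simp [h]

lemma memLp (hW : IsWienerProcess W P) (t : unitInterval) : MemLp (W t) 2 P :=
  (hW.isGaussianProcess.hasGaussianLaw_eval t).memLp (by simp)

lemma integral_sub_sq (hW : IsWienerProcess W P) {s t : unitInterval} (hst : s ≤ t) :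
    ∫ ω, (W t ω - W s ω) ^ 2 ∂P = t - s := by
  have h := hW.law s t hst
  have h1 := h.variance_eq
  rw [variance_id_gaussianReal, variance_of_integral_eq_zero h.aemeasurable
    (by rw [h.integral_eq]; simp), Real.coe_toNNReal _ (sub_nonneg.2 hst)] at h1
  exact h1

lemma integral_eq_zero (hW : IsWienerProcess W P) (t : unitInterval) : ∫ ω, W t ω ∂P = 0 := by
  have h : ∫ ω, (W t ω - W 0 ω) ∂P = 0 := by
    rw [(hW.law 0 t bot_le).integral_eq]; simp
  rw [← h]
  refine integral_congr_ae ?_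
  filter_upwards [hW.zero] with ω h
  simp [h]

lemma integral_sq (hW : IsWienerProcess W P) (t : unitInterval) : ∫ ω, W t ω ^ 2 ∂P = t := by
  have h := hW.integral_sub_sq (show (0 : unitInterval) ≤ t from bot_le)
  rw [show ((0 : unitInterval) : ℝ) = 0 from rfl, sub_zero] at h
  rw [← h]
  refine integral_congr_ae ?_
  filter_upwards [hW.zero] with ω h
  simp [h]

lemma integral_mul (hW : IsWienerProcess W P) (s t : unitInterval) :
    ∫ ω, W s ω * W t ω ∂P = min (s : ℝ) t := by
  wlog hst : s ≤ t generalizing s t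
  · rw [min_comm, ← this t s (le_of_not_ge hst)]
    simp only [mul_comm]
  have h1 : ∀ u, Integrable (fun ω => W u ω ^ 2) P := fun u => (hW.memLp u).integrable_sq
  have h2 : Integrable (fun ω => (W t ω - W s ω) ^ 2) P :=
    ((hW.memLp t).sub (hW.memLp s)).integrable_sq
  have h3 : ∀ ω, W s ω * W t ω = (1 / 2) * (W s ω ^ 2 + W t ω ^ 2 - (W t ω - W s ω) ^ 2) := by
    intro ω; ring
  simp only [h3]
  rw [integral_const_mul, integral_sub (by exact (h1 s).add (h1 t)) h2, integral_add (h1 s) (h1 t),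
    hW.integral_sq, hW.integral_sq, hW.integral_sub_sq hst, min_eq_left (by exact_mod_cast hst)]
  ring

/-- The class of `W_t` in `L²(P)`. -/
noncomputable def valueLp (hW : IsWienerProcess W P) (t : unitInterval) : Lp ℝ 2 P :=
  (hW.memLp t).toLp (W t)

lemma inner_valueLp (hW : IsWienerProcess W P) (s t : unitInterval) :
    inner ℝ (hW.valueLp s) (hW.valueLp t) = min (s : ℝ) t := by
  rw [← hW.integral_mul, L2.inner_def]
  refine integral_congr_ae ?_
  filter_upwards [(hW.memLp s).coeFn_toLp, (hW.memLp t).coeFn_toLp] with ω h1 h2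
  simp [valueLp, h1, h2, mul_comm]

lemma norm_linearCombination_valueLp (hW : IsWienerProcess W P) (m : unitInterval →₀ ℝ) :
    ‖Finsupp.linearCombination ℝ hW.valueLp m‖ = ‖Finsupp.linearCombination ℝ ramp m‖ := by
  rw [← sq_eq_sq₀ (norm_nonneg _) (norm_nonneg _), norm_linearCombination_sq,
    norm_linearCombination_sq]
  simp only [inner_valueLp, inner_ramp]

/-- The Wiener integral `L²([0,1]) → L²(P)`, the continuous linear map sending `1_{(0, t]}`
to `W_t`. -/
noncomputable def wienerInt (hW : IsWienerProcess W P) : Lp ℝ 2 lebI →L[ℝ] Lp ℝ 2 P :=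
  (Finsupp.linearCombination ℝ hW.valueLp).extendOfNorm (Finsupp.linearCombination ℝ ramp)

lemma wienerInt_linearCombination (hW : IsWienerProcess W P) (m : unitInterval →₀ ℝ) :
    hW.wienerInt (Finsupp.linearCombination ℝ ramp m) =
      Finsupp.linearCombination ℝ hW.valueLp m :=
  LinearMap.extendOfNorm_eq denseRange_linearCombination_ramp
    ⟨1, fun m => by rw [one_mul, hW.norm_linearCombination_valueLp]⟩ m

lemma norm_wienerInt (hW : IsWienerProcess W P) (f : Lp ℝ 2 lebI) : ‖hW.wienerInt f‖ = ‖f‖ := by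
  induction f using denseRange_linearCombination_ramp.induction_on with
  | hp => exact isClosed_eq (by fun_prop) (by fun_prop)
  | ih m => rw [hW.wienerInt_linearCombination, hW.norm_linearCombination_valueLp]

lemma inner_wienerInt (hW : IsWienerProcess W P) (f g : Lp ℝ 2 lebI) :
    inner ℝ (hW.wienerInt f) (hW.wienerInt g) = inner ℝ f g :=
  LinearIsometry.inner_map_map ⟨hW.wienerInt.toLinearMap, hW.norm_wienerInt⟩ f g

lemma integral_wienerInt_mul (hW : IsWienerProcess W P) (f g : Lp ℝ 2 lebI) :
    ∫ ω, hW.wienerInt f ω * hW.wienerInt g ω ∂P = inner ℝ f g := by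
  rw [← hW.inner_wienerInt, L2.inner_def]
  simp [mul_comm]

variable [IsProbabilityMeasure P]

lemma continuous_integral_exp (t : ℝ) :
    Continuous fun Y : Lp ℝ 2 P => ∫ ω, Complex.exp (t * Y ω * Complex.I) ∂P := by
  refine LipschitzWith.continuous (K := ‖t‖₊) (LipschitzWith.of_dist_le_mul fun Y Z => ?_)
  have hi : ∀ Y : Lp ℝ 2 P, Integrable (fun ω => Complex.exp (t * Y ω * Complex.I)) P := by
    intro Y
    refine Integrable.of_bound (C := 1) ?_ (.of_forall fun ω => ?_)
    · have := (Lp.aestronglyMeasurable Y).aemeasurable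
      exact (by fun_prop : AEMeasurable (fun ω => Complex.exp (t * Y ω * Complex.I)) P)
        |>.aestronglyMeasurable
    · rw [← Complex.ofReal_mul, Complex.norm_exp_ofReal_mul_I]
  have hb : ∀ a b : ℝ, ‖Complex.exp (t * a * Complex.I) - Complex.exp (t * b * Complex.I)‖ ≤
      ‖t‖ * ‖a - b‖ := by
    intro a b
    have h : Complex.exp (t * a * Complex.I) - Complex.exp (t * b * Complex.I) =
        Complex.exp ((t * b : ℝ) * Complex.I) *
          (Complex.exp (Complex.I * (t * (a - b) : ℝ)) - 1) := by
      rw [mul_sub, ← Complex.exp_add]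
      push_cast
      ring_nf
    rw [h, norm_mul, Complex.norm_exp_ofReal_mul_I, one_mul, ← norm_mul]
    exact Real.norm_exp_I_mul_ofReal_sub_one_le
  have hYZ : Integrable (fun ω => ‖Y ω - Z ω‖) P :=
    (((Lp.memLp Y).sub (Lp.memLp Z)).integrable (by norm_num)).norm
  rw [dist_eq_norm, dist_eq_norm, ← integral_sub (hi Y) (hi Z)]
  calc _ ≤ ∫ ω, ‖t‖ * ‖Y ω - Z ω‖ ∂P := norm_integral_le_of_norm_le (hYZ.const_mul _)
        (.of_forall fun ω => hb _ _)
    _ = ‖t‖ * (eLpNorm (fun ω => Y ω - Z ω) 1 P).toReal := by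
        rw [integral_const_mul, eLpNorm_one_eq_lintegral_enorm, integral_norm_eq_lintegral_enorm]
        exact (Lp.aestronglyMeasurable Y).sub (Lp.aestronglyMeasurable Z)
    _ ≤ ‖t‖ * (eLpNorm (fun ω => Y ω - Z ω) 2 P).toReal := by
        gcongr
        · exact ((Lp.memLp Y).sub (Lp.memLp Z)).eLpNorm_ne_top
        · exact eLpNorm_le_eLpNorm_of_exponent_le (by norm_num)
            ((Lp.aestronglyMeasurable Y).sub (Lp.aestronglyMeasurable Z))
    _ = _ := by
        rw [Lp.norm_def, eLpNorm_congr_ae (Lp.coeFn_sub Y Z)]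
        rfl

/-- The law of a Wiener integral. It is clear for combinations of the `W_t`, and passes to limits
because characteristic functions are continuous along `L²` convergence. -/
lemma map_wienerInt (hW : IsWienerProcess W P) (f : Lp ℝ 2 lebI) :
    P.map (hW.wienerInt f) = gaussianReal 0 (‖f‖ ^ 2).toNNReal := by
  have hm : ∀ Y : Lp ℝ 2 P, AEMeasurable Y P := fun Y => (Lp.aestronglyMeasurable Y).aemeasurable
  have hchar : ∀ (Y : Lp ℝ 2 P) (t : ℝ), charFun (P.map Y) t =
      ∫ ω, Complex.exp (t * Y ω * Complex.I) ∂P := by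
    intro Y t
    rw [charFun_apply_real, integral_map (hm Y) (by fun_prop)]
  have key : ∀ t : ℝ, ∫ ω, Complex.exp (t * hW.wienerInt f ω * Complex.I) ∂P =
      Complex.exp (-((‖f‖ ^ 2 : ℝ) : ℂ) * t ^ 2 / 2) := by
    intro t
    induction f using denseRange_linearCombination_ramp.induction_on with
    | hp =>
      exact isClosed_eq ((continuous_integral_exp t).comp hW.wienerInt.continuous) (by fun_prop)
    | ih m =>
      rw [← hchar, hW.wienerInt_linearCombination, ← hW.norm_linearCombination_valueLp]
      have hG : IsGaussianProcess (fun (m : unitInterval →₀ ℝ) ω => m.sum fun a c => c * W a ω)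
          P := by
        refine hW.isGaussianProcess.of_isGaussianProcess fun m => ⟨m.support,
          ∑ a : m.support, m a • ContinuousLinearMap.proj a, fun ω => ?_⟩
        simp only [FunLike.coe_sum, FunLike.coe_smul, Finset.sum_apply,
          Pi.smul_apply, ContinuousLinearMap.proj_apply, Finset.restrict, smul_eq_mul]
        exact (Finset.sum_coe_sort m.support fun a => m a * W a ω).symm
      have hlaw := (hG.hasGaussianLaw_eval m).congr
        (coeFn_linearCombination hW.memLp m).symm
      change HasGaussianLaw (Finsupp.linearCombination ℝ hW.valueLp m) P at hlaw
      have hmean : ∫ ω, Finsupp.linearCombination ℝ hW.valueLp m ω ∂P = 0 := by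
        refine (integral_congr_ae (coeFn_linearCombination hW.memLp m)).trans ?_
        simp only [Finsupp.sum]
        rw [integral_finsetSum _ fun a _ => ((hW.memLp a).integrable (by norm_num)).const_mul _]
        simp [integral_const_mul, hW.integral_eq_zero]
      rw [hlaw.map_eq_gaussianReal, hmean, charFun_gaussianReal,
        variance_of_integral_eq_zero (hm _) hmean, ← real_inner_self_eq_norm_sq, L2.inner_def]
      have : ∫ ω, inner ℝ (Finsupp.linearCombination ℝ hW.valueLp m ω)
          (Finsupp.linearCombination ℝ hW.valueLp m ω) ∂P =
          ∫ ω, (Finsupp.linearCombination ℝ hW.valueLp m ω) ^ 2 ∂P := by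
        simp [sq]
      rw [this, Real.coe_toNNReal _ (integral_nonneg fun ω => sq_nonneg _)]
      congr 1
      push_cast
      ring
  have : IsProbabilityMeasure (P.map (hW.wienerInt f)) := Measure.isProbabilityMeasure_map (hm _)
  apply Measure.ext_of_charFun
  ext t
  rw [hchar, key, charFun_gaussianReal, Real.coe_toNNReal _ (sq_nonneg _)]
  congr 1
  push_cast
  ring

/-- Wiener integrals are jointly Gaussian: a linear combination of them is again a Wiener
integral. -/
lemma isGaussianProcess_wienerInt (hW : IsWienerProcess W P) :
    IsGaussianProcess (fun f : Lp ℝ 2 lebI => (hW.wienerInt f : Ω → ℝ)) P := by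
  classical
  have hm : ∀ Y : Lp ℝ 2 P, Measurable Y := fun Y => (Lp.stronglyMeasurable Y).measurable
  refine ⟨fun I => ⟨⟨fun L => ?_⟩⟩⟩
  have hmI : Measurable fun ω => I.restrict fun f : Lp ℝ 2 lebI => hW.wienerInt f ω :=
    measurable_pi_iff.2 fun f => hm _
  have e : (L ∘ fun ω => I.restrict fun f : Lp ℝ 2 lebI => hW.wienerInt f ω) =ᵐ[P]
      hW.wienerInt (∑ f : I, L (Pi.single f 1) • (f : Lp ℝ 2 lebI)) := by
    rw [map_sum]
    have h := coeFn_linearCombination (fun f : Lp ℝ 2 lebI => Lp.memLp (hW.wienerInt f))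
      (∑ f : I, Finsupp.single (f : Lp ℝ 2 lebI) (L (Pi.single f 1)))
    simp only [Lp.toLp_coeFn, map_sum, Finsupp.linearCombination_single] at h
    simp only [map_smul]
    refine EventuallyEq.trans ?_ h.symm
    refine .of_forall fun ω => ?_
    dsimp only [Function.comp]
    rw [← Finsupp.sum_finsetSum_index (by simp) (by simp [add_mul])]
    refine (L.toLinearMap.pi_apply_eq_sum_univ _).trans ?_
    refine Finset.sum_congr rfl fun f _ => ?_
    rw [Finsupp.sum_single_index (by simp), smul_eq_mul, mul_comm]
    congr 1
    change L _ = L _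
    congr 1
    ext j
    simp [Pi.single_apply, eq_comm]
  rw [Measure.map_map L.continuous.measurable hmI]
  have e2 := hW.map_wienerInt (∑ f : I, L (Pi.single f 1) • (f : Lp ℝ 2 lebI))
  rw [← Measure.map_congr e] at e2
  have hG : IsGaussian (P.map (L ∘ fun ω => I.restrict fun f : Lp ℝ 2 lebI =>
    hW.wienerInt f ω)) := e2 ▸ inferInstance
  have := (HasGaussianLaw.mk hG).map_eq_gaussianReal
  rw [this, integral_map hmI.aemeasurable (by fun_prop), variance_map (by fun_prop)
    hmI.aemeasurable]
  rfl

lemma integral_wienerInt (hW : IsWienerProcess W P) (f : Lp ℝ 2 lebI) :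
    ∫ ω, hW.wienerInt f ω ∂P = 0 := by
  have h := integral_map (μ := P) (φ := hW.wienerInt f)
    (Lp.aestronglyMeasurable _).aemeasurable (f := fun x => x) (by fun_prop)
  rw [← h, hW.map_wienerInt]
  simp

end IsWienerProcess

end Wiener

/-! ### The Gaussian noise of a Borel set as a Wiener integral -/

section Noise

variable {Ω : Type*} [MeasurableSpace Ω] {P : Measure Ω}
  {W : unitInterval → Ω → ℝ}

lemma memLp_ramp (t : unitInterval) :
    MemLp ((Set.Ioc (0 : ℝ) t).indicator fun _ => (1 : ℝ)) 2 lebI :=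
  memLp_indicator_const 2 measurableSet_Ioc 1 (Or.inr (measure_ne_top _ _))

/-- The combination of the `1_{(0, t]}` representing a step function. -/
noncomputable def StepFunction.toFinsupp (s : StepFunction) : unitInterval →₀ ℝ :=
  ∑ i, (Finsupp.single (s.right i) (s.coeff i) - Finsupp.single (s.left i) (s.coeff i))

lemma StepFunction.sum_toFinsupp (s : StepFunction) (g : unitInterval → ℝ) :
    (s.toFinsupp.sum fun a c => c * g a) = ∑ i, s.coeff i * (g (s.right i) - g (s.left i)) := by
  rw [StepFunction.toFinsupp, ← Finsupp.sum_finsetSum_index (by simp) (by simp [add_mul])]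
  refine Finset.sum_congr rfl fun i _ => ?_
  rw [Finsupp.sum_sub_index (by intros; ring), Finsupp.sum_single_index (by simp),
    Finsupp.sum_single_index (by simp)]
  ring

lemma StepFunction.toFun_eq (s : StepFunction) (x : ℝ) :
    s.toFun x = s.toFinsupp.sum fun a c => c * (Set.Ioc (0 : ℝ) a).indicator (fun _ => 1) x := by
  rw [s.sum_toFinsupp fun a => (Set.Ioc (0 : ℝ) a).indicator (fun _ => 1) x, StepFunction.toFun]
  refine Finset.sum_congr rfl fun i _ => ?_
  congr 1
  have h1 : (s.left i : ℝ) ≤ s.right i := s.left_le_right i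
  have h2 := (s.left i).2.1
  simp only [Set.indicator_apply, Set.mem_Ioc]
  split_ifs <;> grind

lemma StepFunction.memLp_toFun (s : StepFunction) : MemLp s.toFun 2 lebI := by
  refine (Lp.memLp (Finsupp.linearCombination ℝ ramp s.toFinsupp)).ae_eq ?_
  refine (coeFn_linearCombination memLp_ramp s.toFinsupp).trans (.of_forall fun x => ?_)
  exact (s.toFun_eq x).symm

lemma StepFunction.toLp_toFun (s : StepFunction) :
    s.memLp_toFun.toLp s.toFun = Finsupp.linearCombination ℝ ramp s.toFinsupp := by
  ext1
  refine s.memLp_toFun.coeFn_toLp.trans (EventuallyEq.trans (.of_forall s.toFun_eq) ?_)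
  exact (coeFn_linearCombination memLp_ramp s.toFinsupp).symm

/-- The step function `∑ t, m t * 1_{(0, t]}`. -/
noncomputable def stepOfFinsupp (m : unitInterval →₀ ℝ) : StepFunction where
  num := m.support.card
  coeff i := m (m.support.equivFin.symm i)
  left _ := 0
  right i := m.support.equivFin.symm i
  left_le_right _ := bot_le

lemma toFun_stepOfFinsupp (m : unitInterval →₀ ℝ) (x : ℝ) :
    (stepOfFinsupp m).toFun x =
      m.sum fun a c => c * (Set.Ioc (0 : ℝ) a).indicator (fun _ => 1) x := by
  rw [Finsupp.sum, ← Finset.sum_coe_sort]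
  exact m.support.equivFin.symm.sum_comp
    fun a => m a * (Set.Ioc (0 : ℝ) a).indicator (fun _ => (1 : ℝ)) x

lemma exists_stepFunction_tendsto {f : ℝ → ℝ} (hf : MemLp f 2 lebI) :
    ∃ s : ℕ → StepFunction,
      Tendsto (fun k => eLpNorm (fun x => f x - (s k).toFun x) 2 lebI) atTop (𝓝 0) := by
  obtain ⟨u, hu, hlim⟩ := mem_closure_iff_seq_limit.1
    (denseRange_linearCombination_ramp (hf.toLp f))
  choose m hm using hu
  refine ⟨fun k => stepOfFinsupp (m k), ?_⟩
  rw [Lp.tendsto_Lp_iff_tendsto_eLpNorm'] at hlim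
  refine hlim.congr fun k => ?_
  rw [eLpNorm_sub_comm]
  refine eLpNorm_congr_ae ?_
  rw [← hm k]
  filter_upwards [hf.coeFn_toLp, coeFn_linearCombination memLp_ramp (m k)] with x h1 h2
  rw [Pi.sub_apply, h1, toFun_stepOfFinsupp, ← h2]
  rfl

namespace IsWienerProcess

lemma stepFunction_integral (hW : IsWienerProcess W P) (s : StepFunction) :
    s.integral W =ᵐ[P] hW.wienerInt (s.memLp_toFun.toLp s.toFun) := by
  rw [s.toLp_toFun, hW.wienerInt_linearCombination]
  refine EventuallyEq.trans (.of_forall fun ω => ?_)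
    (coeFn_linearCombination hW.memLp s.toFinsupp).symm
  exact (s.sum_toFinsupp fun a => W a ω).symm

/-- `W(A)` is the Wiener integral of `1_A`. -/
lemma noise_ae_eq (hW : IsWienerProcess W P) {A : Set ℝ} (hA : MeasurableSet A) :
    noise W P A =ᵐ[P] hW.wienerInt (indicatorConstLp 2 hA (measure_ne_top lebI A) 1) := by
  have hf : MemLp (A.indicator fun _ => (1 : ℝ)) 2 lebI :=
    memLp_indicator_const 2 hA 1 (Or.inr (measure_ne_top _ _))
  have hex : ∃ X, IsNoise W P A X := by
    obtain ⟨s, hs⟩ := exists_stepFunction_tendsto hf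
    exact ⟨hW.wienerInt (hf.toLp _), Lp.memLp _, s, hs,
      tendsto_eLpNorm_of_tendsto hW.wienerInt hf (fun k => (s k).memLp_toFun)
        (fun k => hW.stepFunction_integral (s k)) hs⟩
  rw [noise, dif_pos hex]
  obtain ⟨hX, s, hs1, hs2⟩ := hex.choose_spec
  exact ae_eq_of_tendsto_eLpNorm hW.wienerInt hf hX (fun k => (s k).memLp_toFun)
    (fun k => hW.stepFunction_integral (s k)) hs1 hs2

end IsWienerProcess

end Noise

/-! ### Density of elementary functions -/

section Density

/-- The elementary function equal to `F (i / N)` on the box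
`∏ j, [i_j / N, (i_j + 1) / N)` for all tuples `i` of distinct indices, and `0` elsewhere. -/
noncomputable def gridElementary {n : ℕ} (F : (Fin n → ℝ) → ℝ) (N : ℕ) : Elementary n where
  num := N
  A i := Set.Ico (0 : ℝ) 1 ∩ {x | ⌊N * x⌋₊ = i}
  measurableSet i := measurableSet_Ico.inter
    ((Nat.measurable_floor.comp (measurable_const_mul _)) (measurableSet_singleton _))
  subset_Icc i := Set.inter_subset_left.trans Set.Ico_subset_Icc_self
  pairwise_disjoint i j hij := by
    rw [Set.disjoint_left]
    rintro x ⟨-, h1⟩ ⟨-, h2⟩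
    exact hij (Fin.ext (h1.symm.trans h2))
  c i := open Classical in if Function.Injective i then F fun j => (i j : ℝ) / N else 0
  c_eq_zero i j k hjk hi := if_neg fun h => hjk (h hi)

lemma Elementary.toFun_eq_single {n : ℕ} (e : Elementary n) (x : Fin n → ℝ)
    (i : Fin n → Fin e.num) (hi : ∀ j, x j ∈ e.A (i j)) : e.toFun x = e.c i := by
  rw [Elementary.toFun, Finset.sum_eq_single i]
  · simp [hi]
  · intro i' _ hne
    obtain ⟨j, hj⟩ := Function.ne_iff.1 hne
    rw [Finset.prod_eq_zero (Finset.mem_univ j), mul_zero]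
    exact Set.indicator_of_notMem
      (fun h => Set.disjoint_left.1 (e.pairwise_disjoint _ _ hj) h (hi j)) _
  · simp

lemma toFun_gridElementary {n : ℕ} (F : (Fin n → ℝ) → ℝ) {N : ℕ} (hN : 0 < N) {x : Fin n → ℝ}
    (hx : ∀ j, x j ∈ Set.Ico (0 : ℝ) 1) : (gridElementary F N).toFun x =
      open Classical in if Function.Injective (fun j => ⌊N * x j⌋₊) then
        F fun j => (⌊N * x j⌋₊ : ℝ) / N else 0 := by
  have hlt : ∀ j, ⌊N * x j⌋₊ < N := by
    intro j
    rw [Nat.floor_lt (mul_nonneg (Nat.cast_nonneg _) (hx j).1)]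
    have : (0 : ℝ) < N := by exact_mod_cast hN
    nlinarith [(hx j).2]
  rw [(gridElementary F N).toFun_eq_single x (fun j => (⟨⌊N * x j⌋₊, hlt j⟩ : Fin N))
    fun j => ⟨hx j, rfl⟩]
  have h : (Function.Injective fun j => (⟨⌊N * x j⌋₊, hlt j⟩ : Fin N)) ↔
      Function.Injective fun j => ⌊N * x j⌋₊ := by
    simp [Function.Injective]
  by_cases hi : Function.Injective fun j => ⌊N * x j⌋₊
  · rw [if_pos hi]
    exact if_pos (h.2 hi)
  · rw [if_neg hi]
    exact if_neg (mt h.1 hi)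

lemma Elementary.measurable_toFun {n : ℕ} (e : Elementary n) : Measurable e.toFun := by
  have h : ∀ (i : Fin n → Fin e.num) (j : Fin n), Measurable fun x : Fin n → ℝ =>
      (e.A (i j)).indicator (fun _ => (1 : ℝ)) (x j) := fun i j =>
    (measurable_const.indicator (e.measurableSet _)).comp (measurable_pi_apply j)
  unfold Elementary.toFun
  fun_prop

instance (n : ℕ) : IsFiniteMeasure (cube n) := by unfold cube; infer_instance

lemma Elementary.memLp_toFun {n : ℕ} (e : Elementary n) : MemLp e.toFun 2 (cube n) := by
  refine MemLp.of_bound e.measurable_toFun.aestronglyMeasurable (∑ i, |e.c i|)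
    (.of_forall fun x => ?_)
  rw [Real.norm_eq_abs, Elementary.toFun]
  refine (Finset.abs_sum_le_sum_abs _ _).trans (Finset.sum_le_sum fun i _ => ?_)
  rw [abs_mul, Finset.abs_prod]
  refine mul_le_of_le_one_right (abs_nonneg _) (Finset.prod_le_one (fun _ _ => abs_nonneg _)
    fun j _ => ?_)
  classical
  rw [Set.indicator_apply]
  split_ifs <;> simp

/-- Off the diagonals, the discretizations of a continuous function converge to it. -/
lemma tendsto_toFun_gridElementary {n : ℕ} {F : (Fin n → ℝ) → ℝ} (hF : Continuous F)
    {x : Fin n → ℝ} (hx : ∀ j, x j ∈ Set.Ico (0 : ℝ) 1) (hinj : Function.Injective x) :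
    Tendsto (fun N : ℕ => (gridElementary F N).toFun x) atTop (𝓝 (F x)) := by
  have h1 : ∀ j, Tendsto (fun N : ℕ => (⌊N * x j⌋₊ : ℝ) / N) atTop (𝓝 (x j)) := by
    intro j
    have := (tendsto_nat_floor_mul_div_atTop (hx j).1).comp tendsto_natCast_atTop_atTop
    simp only [mul_comm (x j)] at this
    exact this
  have h2 : ∀ᶠ N : ℕ in atTop, Function.Injective fun j => ⌊N * x j⌋₊ := by
    have : ∀ j k, j ≠ k → ∀ᶠ N : ℕ in atTop, ⌊N * x j⌋₊ ≠ ⌊N * x k⌋₊ := by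
      intro j k hjk
      have hne : x j ≠ x k := hinj.ne hjk
      have := ((h1 j).sub (h1 k)).eventually_ne (sub_ne_zero.2 hne)
      filter_upwards [this] with N hN h
      simp [h] at hN
    have h3 : ∀ᶠ N : ℕ in atTop, ∀ j k, j ≠ k → ⌊N * x j⌋₊ ≠ ⌊N * x k⌋₊ := by
      simpa only [eventually_all] using this
    filter_upwards [h3] with N hN j k hjk
    by_contra hne
    exact hN j k hne hjk
  have h3 := (hF.tendsto x).comp (tendsto_pi_nhds.2 h1)
  refine h3.congr' ?_
  filter_upwards [h2, eventually_gt_atTop 0] with N hN h0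
  rw [toFun_gridElementary F h0 hx, if_pos hN]
  rfl

lemma ae_cube_injective (n : ℕ) : ∀ᵐ x ∂(cube n), Function.Injective x := by
  have h1 : ∀ j k : Fin n, j ≠ k → ∀ᵐ x ∂(cube n), x j ≠ x k := by
    intro j k hjk
    rw [cube, ← Measure.restrict_pi_pi, ← volume_pi]
    refine ae_restrict_of_ae ?_
    let L : (Fin n → ℝ) →ₗ[ℝ] ℝ := LinearMap.proj (R := ℝ) (φ := fun _ => ℝ) j -
      LinearMap.proj (R := ℝ) (φ := fun _ => ℝ) k
    have hL : ∀ x, L x = x j - x k := fun x => rfl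
    have h := Measure.addHaar_submodule (volume : Measure (Fin n → ℝ)) (LinearMap.ker L) (by
      intro h
      have h2 : L (Pi.single j 1) = 0 := LinearMap.mem_ker.1 (h ▸ Submodule.mem_top)
      rw [hL, Pi.single_eq_same, Pi.single_eq_of_ne hjk.symm] at h2
      simp at h2)
    refine measure_mono_null (fun x hx => ?_) h
    simpa [hL, sub_eq_zero] using hx
  have h2 : ∀ᵐ x ∂(cube n), ∀ j k, j ≠ k → x j ≠ x k := by
    simpa only [ae_all_iff] using h1
  filter_upwards [h2] with x hx j k hjk
  by_contra hne
  exact hx j k hne hjk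

lemma ae_cube_mem_Ico (n : ℕ) : ∀ᵐ x ∂(cube n), ∀ j, x j ∈ Set.Ico (0 : ℝ) 1 := by
  rw [ae_all_iff]
  intro j
  have h : ∀ᵐ y ∂lebI, y ∈ Set.Ico (0 : ℝ) 1 := by
    have h1 : ∀ᵐ y : ℝ, y ≠ 1 := by simp [ae_iff]
    filter_upwards [ae_restrict_mem measurableSet_Icc, ae_restrict_of_ae h1] with y h2 h3
    exact ⟨h2.1, lt_of_le_of_ne h2.2 h3⟩
  exact (Measure.quasiMeasurePreserving_eval (fun _ : Fin n => lebI) j).ae h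

lemma tendsto_eLpNorm_gridElementary {n : ℕ} (F : BoundedContinuousFunction (Fin n → ℝ) ℝ) :
    Tendsto (fun N : ℕ => eLpNorm (fun x => F x - (gridElementary F N).toFun x) 2 (cube n))
      atTop (𝓝 0) := by
  have h2 : ((2 : ENNReal)).toReal = 2 := by simp
  simp only [eLpNorm_eq_lintegral_rpow_enorm_toReal (two_ne_zero) (ENNReal.ofNat_ne_top), h2]
  rw [show (0 : ENNReal) = 0 ^ (1 / (2 : ℝ)) by simp]
  refine (ENNReal.continuous_rpow_const.tendsto _).comp ?_
  have hb : ∀ᶠ N : ℕ in atTop, ∀ᵐ x ∂(cube n),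
      ‖F x - (gridElementary F N).toFun x‖ₑ ^ (2 : ℝ) ≤ ENNReal.ofReal (2 * ‖F‖) ^ (2 : ℝ) := by
    filter_upwards [eventually_gt_atTop 0] with N hN
    filter_upwards [ae_cube_mem_Ico n] with x hx
    refine ENNReal.rpow_le_rpow ?_ (by norm_num)
    rw [← ofReal_norm]
    refine ENNReal.ofReal_le_ofReal ((norm_sub_le _ _).trans ?_)
    rw [two_mul]
    refine add_le_add (F.norm_coe_le_norm x) ?_
    rw [toFun_gridElementary F hN hx]
    split_ifs
    · exact F.norm_coe_le_norm _
    · simp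
  have := tendsto_lintegral_filter_of_dominated_convergence (μ := cube n)
    (F := fun N x => ‖F x - (gridElementary F N).toFun x‖ₑ ^ (2 : ℝ)) (f := fun _ => 0)
    (fun _ => ENNReal.ofReal (2 * ‖F‖) ^ (2 : ℝ))
    (.of_forall fun N => ((F.continuous.measurable.sub
      (Elementary.measurable_toFun _)).enorm.pow_const _)) hb (by
        rw [lintegral_const]
        exact ENNReal.mul_ne_top (ENNReal.rpow_ne_top_of_nonneg (by norm_num)
          ENNReal.ofReal_ne_top) (measure_ne_top _ _)) (by
      filter_upwards [ae_cube_mem_Ico n, ae_cube_injective n] with x h1 h2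
      have h3 := (tendsto_const_nhds (x := F x)).sub
        (tendsto_toFun_gridElementary F.continuous h1 h2)
      rw [sub_self] at h3
      have h4 := (ENNReal.continuous_rpow_const (y := 2)).tendsto _ |>.comp h3.enorm
      simpa [Function.comp_def] using h4)
  simpa using this

/-- Elementary functions are dense in `L²([0,1]^n)`: continuous functions are, and they are limits
of elementary functions because the diagonals are null sets. -/
lemma exists_elementary_tendsto {n : ℕ} {f : (Fin n → ℝ) → ℝ} (hf : MemLp f 2 (cube n)) :
    ∃ e : ℕ → Elementary n,
      Tendsto (fun k => eLpNorm (fun x => f x - (e k).toFun x) 2 (cube n)) atTop (𝓝 0) := by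
  have key : ∀ k : ℕ, ∃ e : Elementary n,
      eLpNorm (fun x => f x - e.toFun x) 2 (cube n) ≤ ((k : ENNReal) + 1)⁻¹ := by
    intro k
    set ε : ENNReal := ((k : ENNReal) + 1)⁻¹ with hε
    have hε0 : ε / 2 ≠ 0 := by simp [hε]
    obtain ⟨F, hF, hFm⟩ := hf.exists_boundedContinuous_eLpNorm_sub_le (by simp) hε0
    obtain ⟨N, hN⟩ := ((tendsto_eLpNorm_gridElementary F).eventually
      (gt_mem_nhds hε0.bot_lt)).exists
    refine ⟨gridElementary F N, ?_⟩
    calc _ = eLpNorm ((f - ⇑F) + fun x => F x - (gridElementary F N).toFun x) 2 (cube n) := by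
          congr 1; ext x; simp
      _ ≤ _ := eLpNorm_add_le (hf.1.sub hFm.1)
          (hFm.1.sub (Elementary.memLp_toFun _).1) (by norm_num)
      _ ≤ ε / 2 + ε / 2 := add_le_add hF hN.le
      _ = ε := ENNReal.add_halves ε
  choose e he using key
  refine ⟨e, tendsto_of_tendsto_of_tendsto_of_le_of_le tendsto_const_nhds ?_ (fun _ => zero_le)
    he⟩
  have := (ENNReal.tendsto_inv_nat_nhds_zero).comp (tendsto_add_atTop_nat 1)
  simpa [Function.comp_def] using this

end Density

/-! ### The multiple Wiener–Itô integral -/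

section Tensor

variable {n : ℕ}

/-- The tensor product `g_1 ⊗ ⋯ ⊗ g_n` as a function on `ℝ^n`. -/
noncomputable def tensorFun (g : Fin n → Lp ℝ 2 lebI) (x : Fin n → ℝ) : ℝ := ∏ i, g i (x i)

lemma integral_tensorFun_mul (g h : Fin n → Lp ℝ 2 lebI) :
    ∫ x, tensorFun g x * tensorFun h x ∂(cube n) = ∏ i, inner ℝ (g i) (h i) := by
  simp only [tensorFun, ← Finset.prod_mul_distrib]
  rw [cube, integral_fintype_prod_eq_prod (fun i y => g i y * h i y)]
  refine Finset.prod_congr rfl fun i _ => ?_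
  rw [L2.inner_def]
  simp [mul_comm]

lemma memLp_prod {G : Fin n → ℝ → ℝ} (hG : ∀ i, MemLp (G i) 2 lebI) :
    MemLp (fun x : Fin n → ℝ => ∏ i, G i (x i)) 2 (cube n) := by
  have hm : AEStronglyMeasurable (fun x : Fin n → ℝ => ∏ i, G i (x i)) (cube n) :=
    Finset.aestronglyMeasurable_fun_prod _ fun i _ => (hG i).1.comp_quasiMeasurePreserving
      (Measure.quasiMeasurePreserving_eval (fun _ : Fin n => lebI) i)
  rw [memLp_two_iff_integrable_sq hm]
  simp only [← Finset.prod_pow]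
  exact Integrable.fintype_prod (f := fun i y => G i y ^ 2) fun i => (hG i).integrable_sq

lemma memLp_tensorFun (g : Fin n → Lp ℝ 2 lebI) : MemLp (tensorFun g) 2 (cube n) :=
  memLp_prod fun i => Lp.memLp (g i)

/-- The tensor product `g_1 ⊗ ⋯ ⊗ g_n` in `L²([0,1]^n)`. -/
noncomputable def tensorLp (g : Fin n → Lp ℝ 2 lebI) : Lp ℝ 2 (cube n) :=
  (memLp_tensorFun g).toLp (tensorFun g)

lemma inner_tensorLp (g h : Fin n → Lp ℝ 2 lebI) :
    inner ℝ (tensorLp g) (tensorLp h) = ∏ i, inner ℝ (g i) (h i) := by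
  rw [← integral_tensorFun_mul, L2.inner_def]
  refine integral_congr_ae ?_
  filter_upwards [(memLp_tensorFun g).coeFn_toLp, (memLp_tensorFun h).coeFn_toLp] with x h1 h2
  simp [tensorLp, h1, h2, mul_comm]

lemma prod_ae_eq_tensorFun {G : Fin n → ℝ → ℝ} {g : Fin n → Lp ℝ 2 lebI}
    (hG : ∀ i, G i =ᵐ[lebI] g i) :
    (fun x : Fin n → ℝ => ∏ i, G i (x i)) =ᵐ[cube n] tensorFun g := by
  have h : ∀ᵐ x ∂(cube n), ∀ i, G i (x i) = g i (x i) := ae_all_iff.2 fun i =>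
    (Measure.quasiMeasurePreserving_eval (fun _ : Fin n => lebI) i).ae (hG i)
  filter_upwards [h] with x hx
  simp [tensorFun, hx]

/-- The class of `1_A` in `L²([0,1])`. -/
noncomputable def indLp (A : Set ℝ) (hA : MeasurableSet A) : Lp ℝ 2 lebI :=
  indicatorConstLp 2 hA (measure_ne_top lebI A) 1

/-- The combination of tensor products of indicators representing an elementary function. -/
noncomputable def Elementary.toFinsupp (e : Elementary n) : (Fin n → Lp ℝ 2 lebI) →₀ ℝ :=
  ∑ i : Fin n → Fin e.num,
    Finsupp.single (fun j => indLp (e.A (i j)) (e.measurableSet _)) (e.c i)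

lemma Elementary.sum_toFinsupp (e : Elementary n) (F : (Fin n → Lp ℝ 2 lebI) → ℝ) :
    (e.toFinsupp.sum fun g c => c * F g) =
      ∑ i : Fin n → Fin e.num, e.c i * F fun j => indLp (e.A (i j)) (e.measurableSet _) := by
  rw [Elementary.toFinsupp, ← Finsupp.sum_finsetSum_index (by simp) (by simp [add_mul])]
  exact Finset.sum_congr rfl fun i _ => Finsupp.sum_single_index (by simp)

lemma Elementary.toLp_toFun (e : Elementary n) :
    e.memLp_toFun.toLp e.toFun = Finsupp.linearCombination ℝ tensorLp e.toFinsupp := by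
  ext1
  refine e.memLp_toFun.coeFn_toLp.trans (EventuallyEq.trans ?_
    (coeFn_linearCombination memLp_tensorFun e.toFinsupp).symm)
  have h : ∀ᵐ x ∂(cube n), ∀ i : Fin n → Fin e.num,
      ∏ j, (e.A (i j)).indicator (fun _ => (1 : ℝ)) (x j) =
        tensorFun (fun j => indLp (e.A (i j)) (e.measurableSet _)) x :=
    ae_all_iff.2 fun i => prod_ae_eq_tensorFun fun j => indicatorConstLp_coeFn.symm
  filter_upwards [h] with x hx
  rw [e.sum_toFinsupp fun g => tensorFun g x, Elementary.toFun]
  simp only [hx]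

lemma denseRange_linearCombination_tensorLp :
    DenseRange (Finsupp.linearCombination ℝ (tensorLp (n := n))) := by
  intro f
  obtain ⟨e, he⟩ := exists_elementary_tendsto (Lp.memLp f)
  refine mem_closure_iff_seq_limit.2 ⟨fun k => (e k).memLp_toFun.toLp (e k).toFun,
    fun k => ⟨(e k).toFinsupp, (e k).toLp_toFun.symm⟩, ?_⟩
  rw [Lp.tendsto_Lp_iff_tendsto_eLpNorm']
  refine he.congr fun k => ?_
  rw [eLpNorm_sub_comm]
  refine eLpNorm_congr_ae ?_
  filter_upwards [(e k).memLp_toFun.coeFn_toLp] with x hx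
  simp [hx]

end Tensor

section MultipleIntegral

variable {Ω : Type*} [MeasurableSpace Ω] {P : Measure Ω}
  {W : unitInterval → Ω → ℝ} {n : ℕ}

namespace IsWienerProcess

/-- The Wick product `:W(g_1) ⋯ W(g_n):` as a random variable. -/
noncomputable def wickProd (hW : IsWienerProcess W P) (g : Fin n → Lp ℝ 2 lebI) (ω : Ω) : ℝ :=
  (wick (inner ℝ) (List.ofFn g)).eval fun h => hW.wienerInt h ω

/-- The Wick product as an alternating sum over partial pairings. -/
lemma wickProd_eq (hW : IsWienerProcess W P) (g : Fin n → Lp ℝ 2 lebI) (ω : Ω) :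
    hW.wickProd g ω = ∏ i, hW.wienerInt (g i) ω +
      ∑ l ∈ Finset.Icc 1 (n / 2), (-1) ^ l / (2 ^ l * (l.factorial : ℝ)) *
        ∑ k : Fin (2 * l) ↪ Fin n, (∏ u with ∀ m, k m ≠ u, hW.wienerInt (g u) ω) *
          ∏ j : Fin l, inner ℝ (g (k ⟨2 * (j : ℕ), two_mul_val_lt j⟩))
            (g (k ⟨2 * (j : ℕ) + 1, two_mul_val_add_one_lt j⟩)) := by
  have h : List.ofFn g = (List.ofFn id).map g := by rw [List.map_ofFn]; rfl
  rw [wickProd, h, ← rename_wick, MvPolynomial.eval_rename,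
    wick_ofFn_id _ fun i j => real_inner_comm _ _]
  simp only [map_add, map_prod, map_sum, MvPolynomial.smul_eval, MvPolynomial.eval_X,
    Function.comp]
  congr 1
  refine Finset.sum_congr rfl fun l _ => ?_
  congr 1
  exact Finset.sum_congr rfl fun k _ => mul_comm _ _

lemma wickProd_one (hW : IsWienerProcess W P) (g : Fin 1 → Lp ℝ 2 lebI) (ω : Ω) :
    hW.wickProd g ω = hW.wienerInt (g 0) ω := by
  simp [wickProd, wick]

variable [IsProbabilityMeasure P]

lemma memLp_eval_wienerInt (hW : IsWienerProcess W P) (p : MvPolynomial (Lp ℝ 2 lebI) ℝ) :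
    MemLp (fun ω => p.eval fun g => hW.wienerInt g ω) 2 P :=
  memLp_eval_mvPolynomial
    (fun g _ hr => (hW.isGaussianProcess_wienerInt.hasGaussianLaw_eval g).memLp hr) p 2 (by simp)

lemma memLp_wickProd (hW : IsWienerProcess W P) (g : Fin n → Lp ℝ 2 lebI) :
    MemLp (hW.wickProd g) 2 P :=
  hW.memLp_eval_wienerInt _

lemma integral_wickProd_mul (hW : IsWienerProcess W P) (g h : Fin n → Lp ℝ 2 lebI) :
    ∫ ω, hW.wickProd g ω * hW.wickProd h ω ∂P =
      ∑ σ : Equiv.Perm (Fin n), ∏ i, inner ℝ (g i) (h (σ i)) := by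
  have hint : ∀ p : MvPolynomial (Lp ℝ 2 lebI) ℝ,
      Integrable (fun ω => p.eval fun g => hW.wienerInt g ω) P := fun p =>
    (hW.memLp_eval_wienerInt p).integrable (by norm_num)
  let E : MvPolynomial (Lp ℝ 2 lebI) ℝ →ₗ[ℝ] ℝ :=
    { toFun := fun p => ∫ ω, p.eval (fun g => hW.wienerInt g ω) ∂P
      map_add' := fun p q => by
        simp only [map_add]
        exact integral_add (hint p) (hint q)
      map_smul' := fun c p => by
        simp only [MvPolynomial.smul_eval, RingHom.id_apply, smul_eq_mul]
        exact integral_const_mul _ _ }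
  have h := wick_mul_wick (inner ℝ) E (by simp [E]) (fun f p => by
    have := integral_mul_eval_gaussianProcess hW.isGaussianProcess_wienerInt
      (fun f => (Lp.stronglyMeasurable _).measurable) hW.integral_wienerInt f p
    simp only [hW.integral_wienerInt_mul] at this
    exact this) g h
  rw [← h]
  simp only [wickProd, ← map_mul]
  rfl

/-- The class of `:W(g_1) ⋯ W(g_n):` in `L²(P)`. -/
noncomputable def wickLp (hW : IsWienerProcess W P) (g : Fin n → Lp ℝ 2 lebI) : Lp ℝ 2 P :=
  (hW.memLp_wickProd g).toLp (hW.wickProd g)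

lemma inner_wickLp (hW : IsWienerProcess W P) (g h : Fin n → Lp ℝ 2 lebI) :
    inner ℝ (hW.wickLp g) (hW.wickLp h) =
      ∑ σ : Equiv.Perm (Fin n), inner ℝ (tensorLp g) (tensorLp (h ∘ σ)) := by
  simp only [inner_tensorLp, Function.comp]
  rw [← hW.integral_wickProd_mul, L2.inner_def]
  refine integral_congr_ae ?_
  filter_upwards [(hW.memLp_wickProd g).coeFn_toLp, (hW.memLp_wickProd h).coeFn_toLp] with x h1 h2
  simp [wickLp, h1, h2, mul_comm]

/-- The `L²` bound `E[I_n(f)²] ≤ n! ‖f‖²`, for combinations `f` of tensor products. -/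
lemma norm_linearCombination_wickLp_le (hW : IsWienerProcess W P)
    (m : (Fin n → Lp ℝ 2 lebI) →₀ ℝ) :
    ‖Finsupp.linearCombination ℝ hW.wickLp m‖ ≤
      √(n.factorial) * ‖Finsupp.linearCombination ℝ tensorLp m‖ := by
  have hσ : ∀ σ : Equiv.Perm (Fin n),
      ‖Finsupp.linearCombination ℝ (fun g => tensorLp (g ∘ σ)) m‖ =
        ‖Finsupp.linearCombination ℝ tensorLp m‖ := by
    intro σ
    rw [← sq_eq_sq₀ (norm_nonneg _) (norm_nonneg _), norm_linearCombination_sq,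
      norm_linearCombination_sq]
    simp only [inner_tensorLp, Function.comp]
    refine Finsupp.sum_congr fun g _ => Finsupp.sum_congr fun h _ => ?_
    rw [Equiv.prod_comp σ fun i => inner ℝ (h i) (g i)]
  have h1 : ‖Finsupp.linearCombination ℝ hW.wickLp m‖ ^ 2 = ∑ σ : Equiv.Perm (Fin n),
      inner ℝ (Finsupp.linearCombination ℝ (fun g => tensorLp (g ∘ σ)) m)
        (Finsupp.linearCombination ℝ tensorLp m) := by
    rw [norm_linearCombination_sq]
    have h2 : ∀ σ : Equiv.Perm (Fin n), ∀ g : Fin n → Lp ℝ 2 lebI,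
        inner ℝ (tensorLp (g ∘ σ)) (Finsupp.linearCombination ℝ tensorLp m) =
          ∑ h ∈ m.support, m h * inner ℝ (tensorLp h) (tensorLp (g ∘ σ)) := by
      intro σ g
      rw [real_inner_comm, inner_linearCombination, Finsupp.sum]
    simp only [inner_linearCombination, inner_wickLp, Finsupp.sum, Finset.mul_sum, h2]
    rw [Finset.sum_comm (s := Finset.univ)]
    exact Finset.sum_congr rfl fun g _ => Finset.sum_comm
  rw [← sq_le_sq₀ (norm_nonneg _) (by positivity), h1, mul_pow,
    Real.sq_sqrt (Nat.cast_nonneg _)]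
  calc _ ≤ ∑ σ : Equiv.Perm (Fin n), ‖Finsupp.linearCombination ℝ tensorLp m‖ ^ 2 := by
        refine Finset.sum_le_sum fun σ _ => (real_inner_le_norm _ _).trans ?_
        rw [hσ, sq]
    _ = _ := by simp [Fintype.card_perm]

/-- The multiple Wiener–Itô integral as a continuous linear map `L²([0,1]^n) → L²(P)`; it sends
`g_1 ⊗ ⋯ ⊗ g_n` to the Wick product `:W(g_1) ⋯ W(g_n):`. -/
noncomputable def multInt (hW : IsWienerProcess W P) (n : ℕ) : Lp ℝ 2 (cube n) →L[ℝ] Lp ℝ 2 P :=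
  (Finsupp.linearCombination ℝ (hW.wickLp (n := n))).extendOfNorm
    (Finsupp.linearCombination ℝ tensorLp)

lemma multInt_linearCombination (hW : IsWienerProcess W P) (m : (Fin n → Lp ℝ 2 lebI) →₀ ℝ) :
    hW.multInt n (Finsupp.linearCombination ℝ tensorLp m) =
      Finsupp.linearCombination ℝ hW.wickLp m :=
  LinearMap.extendOfNorm_eq denseRange_linearCombination_tensorLp
    ⟨_, hW.norm_linearCombination_wickLp_le⟩ m

lemma multInt_tensorLp (hW : IsWienerProcess W P) (g : Fin n → Lp ℝ 2 lebI) :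
    hW.multInt n (tensorLp g) = hW.wickLp g := by
  simpa using hW.multInt_linearCombination (Finsupp.single g 1)

/-- On products of disjoint sets, the Wick product is the ordinary one, so that `multInt` extends
the integral of elementary functions. -/
lemma elementary_integral (hW : IsWienerProcess W P) (e : Elementary n) :
    e.integral W P =ᵐ[P] hW.multInt n (e.memLp_toFun.toLp e.toFun) := by
  rw [e.toLp_toFun, hW.multInt_linearCombination]
  refine EventuallyEq.trans ?_ (coeFn_linearCombination hW.memLp_wickProd e.toFinsupp).symm
  have h : ∀ᵐ ω ∂P, ∀ i, noise W P (e.A i) ω =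
      hW.wienerInt (indLp (e.A i) (e.measurableSet i)) ω :=
    ae_all_iff.2 fun i => hW.noise_ae_eq (e.measurableSet i)
  filter_upwards [h] with ω hω
  rw [e.sum_toFinsupp fun g => hW.wickProd g ω, Elementary.integral]
  refine Finset.sum_congr rfl fun i _ => ?_
  by_cases hi : Function.Injective i
  · rw [wickProd, wick_eq_prod, List.map_ofFn, List.prod_ofFn]
    · simp [hω]
    · rw [List.pairwise_ofFn]
      intro j k hjk
      rw [indLp, indLp, L2.inner_indicatorConstLp_indicatorConstLp,
        (e.pairwise_disjoint _ _ (hi.ne hjk.ne)).inter_eq]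
      simp
  · obtain ⟨j, k, hjk, hne⟩ : ∃ j k, i j = i k ∧ j ≠ k := by
      simpa [Function.Injective] using hi
    simp [e.c_eq_zero i j k hne hjk]

lemma isMultipleIntegral_multInt (hW : IsWienerProcess W P) {f : (Fin n → ℝ) → ℝ}
    (hf : MemLp f 2 (cube n)) : IsMultipleIntegral W P f (hW.multInt n (hf.toLp f)) := by
  obtain ⟨e, he⟩ := exists_elementary_tendsto hf
  exact ⟨Lp.memLp _, e, he, tendsto_eLpNorm_of_tendsto (hW.multInt n) hf
    (fun k => (e k).memLp_toFun) (fun k => hW.elementary_integral (e k)) he⟩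

lemma isMultipleIntegral_multipleIntegral (hW : IsWienerProcess W P) {f : (Fin n → ℝ) → ℝ}
    (hf : MemLp f 2 (cube n)) : IsMultipleIntegral W P f (multipleIntegral W P f) := by
  have hex : ∃ X, IsMultipleIntegral W P f X := ⟨_, hW.isMultipleIntegral_multInt hf⟩
  rw [multipleIntegral, dif_pos hex]
  exact hex.choose_spec

lemma multipleIntegral_ae_eq (hW : IsWienerProcess W P) {f : (Fin n → ℝ) → ℝ}
    (hf : MemLp f 2 (cube n)) : multipleIntegral W P f =ᵐ[P] hW.multInt n (hf.toLp f) := by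
  obtain ⟨hX, e, he1, he2⟩ := hW.isMultipleIntegral_multipleIntegral hf
  exact ae_eq_of_tendsto_eLpNorm (hW.multInt n) hf hX (fun k => (e k).memLp_toFun)
    (fun k => hW.elementary_integral (e k)) he1 he2

lemma multipleIntegral_prod (hW : IsWienerProcess W P) {G : Fin n → ℝ → ℝ}
    (hG : ∀ i, MemLp (G i) 2 lebI) :
    multipleIntegral W P (fun x : Fin n → ℝ => ∏ i, G i (x i)) =ᵐ[P]
      hW.wickProd fun i => (hG i).toLp (G i) := by
  refine (hW.multipleIntegral_ae_eq (memLp_prod hG)).trans ?_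
  have h : (memLp_prod hG).toLp _ = tensorLp fun i => (hG i).toLp (G i) :=
    MemLp.toLp_congr _ _ (prod_ae_eq_tensorFun fun i => (hG i).coeFn_toLp.symm)
  rw [h, hW.multInt_tensorLp]
  exact (hW.memLp_wickProd _).coeFn_toLp

/-- The product formula for multiple Wiener–Itô integrals of tensor products. -/
lemma multipleIntegral_prod_eq (hW : IsWienerProcess W P) {G : Fin n → ℝ → ℝ}
    (hG : ∀ i, MemLp (G i) 2 lebI) :
    ∀ᵐ ω ∂P, multipleIntegral W P (fun x : Fin n → ℝ => ∏ i, G i (x i)) ω =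
      ∏ i, multipleIntegral W P (fun x : Fin 1 → ℝ => G i (x 0)) ω +
      ∑ l ∈ Finset.Icc 1 (n / 2), (-1) ^ l / (2 ^ l * (l.factorial : ℝ)) *
        ∑ k : Fin (2 * l) ↪ Fin n,
          (∏ u with ∀ m, k m ≠ u, multipleIntegral W P (fun x : Fin 1 → ℝ => G u (x 0)) ω) *
          ∏ j : Fin l, ∫ t, G (k ⟨2 * (j : ℕ), two_mul_val_lt j⟩) t *
            G (k ⟨2 * (j : ℕ) + 1, two_mul_val_add_one_lt j⟩) t ∂lebI := by
  have h1 : ∀ᵐ ω ∂P, ∀ i, multipleIntegral W P (fun x : Fin 1 → ℝ => G i (x 0)) ω =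
      hW.wienerInt ((hG i).toLp (G i)) ω := by
    refine ae_all_iff.2 fun i => ?_
    have h := hW.multipleIntegral_prod (n := 1) (G := fun _ => G i) fun _ => hG i
    simp only [Fin.prod_univ_one] at h
    filter_upwards [h] with ω hω
    rw [hω, wickProd_one]
  have h2 : ∀ i j, ∫ t, G i t * G j t ∂lebI =
      inner ℝ ((hG i).toLp (G i)) ((hG j).toLp (G j)) := by
    intro i j
    rw [L2.inner_def]
    refine integral_congr_ae ?_
    filter_upwards [(hG i).coeFn_toLp, (hG j).coeFn_toLp] with t e1 e2
    simp [e1, e2, mul_comm]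
  filter_upwards [h1, hW.multipleIntegral_prod hG] with ω e1 e2
  simp only [e1, e2, h2, wickProd_eq]

end IsWienerProcess

end MultipleIntegral

/-! ### The kernel of the transfer operator -/

section Fractional

open scoped ENNReal

variable {H : ℝ}

/-- The one-dimensional transfer operator `Γ_H^{(1)}`, for functions of one real variable rather
than functions on `Fin 1 → ℝ`. -/
noncomputable def transferOne (H : ℝ) (f : ℝ → ℝ) (t : ℝ) : ℝ :=
  cH H * Real.Gamma (H + 1 / 2) * t ^ (1 / 2 - H) * (1 / Real.Gamma (H - 1 / 2) *
    ∫ s in Set.Ioc t 1, f s * s ^ (H - 1 / 2) / (s - t) ^ (1 - (H - 1 / 2)))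

/-- The transfer operator acts on tensor products factor by factor. No integrability is needed: the
Fubini theorem for tensor products holds unconditionally. -/
lemma transfer_tensor (H : ℝ) {n : ℕ} (f : Fin n → ℝ → ℝ) :
    transfer H (tensor f) = fun t => ∏ j, transferOne H (f j) (t j) := by
  ext t
  have h : ∫ s in Set.pi Set.univ (fun j => Set.Ioc (t j) 1),
      (tensor f s * ∏ j, s j ^ (H - 1 / 2)) / ∏ j, (s j - t j) ^ (1 - (H - 1 / 2)) =
        ∏ j, ∫ s in Set.Ioc (t j) 1, f j s * s ^ (H - 1 / 2) /
          (s - t j) ^ (1 - (H - 1 / 2)) := by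
    rw [volume_pi, Measure.restrict_pi_pi, ← integral_fintype_prod_eq_prod
      (fun j s => f j s * s ^ (H - 1 / 2) / (s - t j) ^ (1 - (H - 1 / 2)))]
    simp only [tensor, Finset.prod_mul_distrib, Finset.prod_div_distrib]
  rw [transfer, fracIntegral, h]
  simp only [transferOne, Finset.prod_mul_distrib, Finset.prod_const, Finset.card_univ,
    Fintype.card_fin, one_div, inv_pow, mul_pow]

lemma transfer_single (H : ℝ) (f : ℝ → ℝ) :
    transfer H (single f) = fun t => transferOne H f (t 0) := by
  have h : single f = tensor fun _ : Fin 1 => f := by ext x; simp [single, tensor]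
  rw [h, transfer_tensor]
  simp

lemma psi_nonneg (hH : 1 / 2 < H) (s t : ℝ) : 0 ≤ psi H s t :=
  mul_nonneg (mul_nonneg (by linarith) (by linarith)) (Real.rpow_nonneg (abs_nonneg _) _)

/-- The Möbius transformation `t ↦ t (v - u) / (u (v - t))` maps `(0, u)` onto `(0, 1)` and turns
the integral below into Euler's beta integral. -/
lemma lintegral_beta_kernel {a b u v : ℝ} (ha : -1 < a) (hb : -1 < b) (hab : a + 2 * b + 2 = 0)
    (hu : 0 < u) (huv : u < v) :
    ∫⁻ t in Set.Ioo 0 u, ENNReal.ofReal (t ^ a * (u - t) ^ b * (v - t) ^ b) =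
      ENNReal.ofReal (beta (a + 1) (b + 1) * (u * v) ^ (-b - 1) * (v - u) ^ (-a - 1)) := by
  have hv : 0 < v := hu.trans huv
  set φ : ℝ → ℝ := fun t => t * (v - u) / (u * (v - t)) with hφ
  have hφ' : ∀ t ∈ Set.Ioo 0 u, HasDerivWithinAt φ ((v - u) * v / (u * (v - t) ^ 2))
      (Set.Ioo 0 u) t := by
    rintro t ⟨h0, h1⟩
    have hne : v - t ≠ 0 := by linarith
    have := ((hasDerivAt_id t).mul_const (v - u)).div
      (((hasDerivAt_id t).const_sub v).const_mul u) (mul_ne_zero hu.ne' hne)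
    refine HasDerivAt.hasDerivWithinAt ?_
    convert! this using 1
    simp only [id]
    field_simp
    ring
  have hinj : Set.InjOn φ (Set.Ioo 0 u) := by
    rintro s ⟨hs0, hs1⟩ t ⟨ht0, ht1⟩ hst
    have h1 : v - s ≠ 0 := by linarith
    have h2 : v - t ≠ 0 := by linarith
    have h3 : v - u ≠ 0 := by linarith
    simp only [hφ] at hst
    rw [div_eq_div_iff (by positivity) (by positivity)] at hst
    have h4 : (u * (v - u) * v) * (s - t) = 0 := by linear_combination hst
    have h5 : u * (v - u) * v ≠ 0 := by positivity
    linarith [(mul_eq_zero.1 h4).resolve_left h5]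
  have himg : φ '' Set.Ioo 0 u = Set.Ioo 0 1 := by
    ext z
    constructor
    · rintro ⟨t, ⟨h0, h1⟩, rfl⟩
      have h2 : 0 < v - t := by linarith
      have h3 : 0 < v - u := by linarith
      refine ⟨by positivity, ?_⟩
      rw [div_lt_one (by positivity)]
      nlinarith
    · rintro ⟨h0, h1⟩
      have h3 : 0 < v - u := by linarith
      have h4 : 0 < v - u + u * z := by positivity
      refine ⟨u * v * z / (v - u + u * z), ⟨by positivity, ?_⟩, ?_⟩
      · rw [div_lt_iff₀ h4]
        nlinarith [mul_pos (mul_pos hu h3) (sub_pos.2 h1)]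
      · have h5 : v - u * v * z / (v - u + u * z) = v * (v - u) / (v - u + u * z) := by
          field_simp
          ring
        simp only [hφ, h5]
        field_simp
  have hbeta : ∫⁻ z in Set.Ioo (0 : ℝ) 1, ENNReal.ofReal (z ^ a * (1 - z) ^ b) =
      ENNReal.ofReal (beta (a + 1) (b + 1)) := by
    have hpos : 0 < beta (a + 1) (b + 1) := beta_pos (by linarith) (by linarith)
    have h := lintegral_betaPDF_eq_one (α := a + 1) (β := b + 1) (by linarith) (by linarith)
    rw [lintegral_betaPDF] at h
    simp only [add_sub_cancel_right, mul_assoc] at h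
    simp only [ENNReal.ofReal_mul (one_div_pos.2 hpos).le] at h
    rw [lintegral_const_mul _ (by fun_prop)] at h
    have h2 : ENNReal.ofReal (beta (a + 1) (b + 1)) * ENNReal.ofReal (1 / beta (a + 1) (b + 1)) =
        1 := by
      rw [← ENNReal.ofReal_mul hpos.le, mul_one_div_cancel hpos.ne', ENNReal.ofReal_one]
    rw [← mul_one (ENNReal.ofReal (beta (a + 1) (b + 1))), ← h, ← mul_assoc, h2, one_mul]
  have hc : 0 ≤ (u * v) ^ (-b - 1) * (v - u) ^ (-a - 1) :=
    mul_nonneg (Real.rpow_nonneg (by positivity) _) (Real.rpow_nonneg (by linarith) _)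
  rw [mul_assoc, mul_comm, ENNReal.ofReal_mul hc, ← hbeta, ← himg,
    lintegral_image_eq_lintegral_abs_deriv_mul measurableSet_Ioo hφ' hinj,
    ← lintegral_const_mul' _ _ ENNReal.ofReal_ne_top]
  refine setLIntegral_congr_fun measurableSet_Ioo ?_
  rintro t ⟨h0, h1⟩
  have h2 : 0 < v - t := by linarith
  have h3 : 0 < v - u := by linarith
  have h4 : 0 < u - t := by linarith
  dsimp only
  rw [← ENNReal.ofReal_mul (abs_nonneg _), ← ENNReal.ofReal_mul hc]
  congr 1
  have e1 : 1 - φ t = v * (u - t) / (u * (v - t)) := by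
    simp only [hφ]
    field_simp
    ring
  have e2 : (v - t) ^ b * (v - t) ^ a * (v - t) ^ b * (v - t) ^ 2 = 1 := by
    rw [← Real.rpow_natCast, ← Real.rpow_add h2, ← Real.rpow_add h2, ← Real.rpow_add h2]
    rw [show b + a + b + ((2 : ℕ) : ℝ) = 0 by push_cast; linarith, Real.rpow_zero]
  have e3 : u ^ a * u ^ b * u ^ b * u ^ 2 = 1 := by
    rw [← Real.rpow_natCast, ← Real.rpow_add hu, ← Real.rpow_add hu, ← Real.rpow_add hu]
    rw [show a + b + b + ((2 : ℕ) : ℝ) = 0 by push_cast; linarith, Real.rpow_zero]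
  rw [e1, abs_of_pos (by positivity)]
  simp only [hφ]
  rw [Real.div_rpow (by positivity) (by positivity), Real.div_rpow (by positivity) (by positivity),
    Real.mul_rpow h0.le h3.le, Real.mul_rpow hu.le h2.le, Real.mul_rpow hv.le h4.le,
    Real.mul_rpow hu.le h2.le, Real.mul_rpow hu.le hv.le,
    show -b - 1 = -(b + 1) by ring, show -a - 1 = -(a + 1) by ring, Real.rpow_neg hu.le,
    Real.rpow_neg hv.le, Real.rpow_neg h3.le, Real.rpow_add_one hu.ne', Real.rpow_add_one hv.ne',
    Real.rpow_add_one h3.ne']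
  have p1 := Real.rpow_pos_of_pos hu a
  have p2 := Real.rpow_pos_of_pos hu b
  have p3 := Real.rpow_pos_of_pos hv b
  have p4 := Real.rpow_pos_of_pos h2 a
  have p5 := Real.rpow_pos_of_pos h2 b
  have p6 := Real.rpow_pos_of_pos h3 a
  generalize u ^ a = U at *
  generalize u ^ b = U' at *
  generalize v ^ b = V at *
  generalize (v - t) ^ a = T at *
  generalize (v - t) ^ b = T' at *
  generalize (v - u) ^ a = D at *
  generalize t ^ a = X
  generalize (u - t) ^ b = Y
  field_simp
  linear_combination X * Y * (U * U' * U' * u ^ 2) * e2 + X * Y * e3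

/-- The normalization constant of the transfer operator. -/
noncomputable def kernelConst (H : ℝ) : ℝ :=
  cH H * Real.Gamma (H + 1 / 2) / Real.Gamma (H - 1 / 2)

lemma kernelConst_nonneg (hH : 1 / 2 < H) : 0 ≤ kernelConst H :=
  div_nonneg (mul_nonneg (Real.sqrt_nonneg _) (Real.Gamma_pos_of_pos (by linarith)).le)
    (Real.Gamma_pos_of_pos (by linarith)).le

/-- The value of `c_H` is chosen to make this identity hold. -/
lemma kernelConst_sq_mul_beta (hH : 1 / 2 < H) (hH1 : H < 1) :
    kernelConst H ^ 2 * beta (1 - 2 * H + 1) (H - 3 / 2 + 1) = H * (2 * H - 1) := by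
  have h1 := Real.Gamma_pos_of_pos (show 0 < H - 1 / 2 by linarith)
  have h2 := Real.Gamma_pos_of_pos (show 0 < H + 1 / 2 by linarith)
  have h3 := Real.Gamma_pos_of_pos (show 0 < 2 - 2 * H by linarith)
  have h4 := Real.Gamma_pos_of_pos (show 0 < 3 / 2 - H by linarith)
  have h5 : Real.Gamma (H + 1 / 2) = (H - 1 / 2) * Real.Gamma (H - 1 / 2) := by
    rw [← Real.Gamma_add_one (by linarith)]
    congr 1
    ring
  rw [beta, show 1 - 2 * H + 1 = 2 - 2 * H by ring, show H - 3 / 2 + 1 = H - 1 / 2 by ring,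
    show 2 - 2 * H + (H - 1 / 2) = 3 / 2 - H by ring, kernelConst, div_pow, mul_pow, cH,
    Real.sq_sqrt (by positivity)]
  rw [h5] at h2 ⊢
  generalize Real.Gamma (H - 1 / 2) = A at *
  generalize Real.Gamma (2 - 2 * H) = B at *
  generalize Real.Gamma (3 / 2 - H) = D at *
  have h6 : H - 1 / 2 ≠ 0 := by linarith
  have h7 : H * 2 - 1 ≠ 0 := by linarith
  field_simp

/-- The kernel of the one-dimensional transfer operator: for `0 ≤ t`, the operator sends `f` to
`t ↦ ∫ f u * kernel H t u du`. -/
noncomputable def kernel (H t u : ℝ) : ℝ :=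
  if t < u then kernelConst H * t ^ (1 / 2 - H) * (u ^ (H - 1 / 2) * (u - t) ^ (H - 3 / 2)) else 0

lemma measurable_kernel (H : ℝ) : Measurable fun p : ℝ × ℝ => kernel H p.1 p.2 := by
  unfold kernel
  exact Measurable.ite (measurableSet_lt measurable_fst measurable_snd) (by fun_prop)
    measurable_const

lemma kernel_nonneg (hH : 1 / 2 < H) {t u : ℝ} (ht : 0 ≤ t) : 0 ≤ kernel H t u := by
  unfold kernel
  split_ifs with h
  · have := kernelConst_nonneg hH
    have h1 : 0 ≤ u := ht.trans h.le
    have h2 : 0 ≤ u - t := by linarith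
    positivity
  · exact le_rfl

lemma transferOne_eq (f : ℝ → ℝ) {t : ℝ} (ht : 0 ≤ t) :
    transferOne H f t = ∫ u, f u * kernel H t u ∂lebI := by
  have h1 : ∀ u, f u * kernel H t u = (Set.Ioi t).indicator
      (fun u => kernelConst H * t ^ (1 / 2 - H) * (f u * u ^ (H - 1 / 2) /
        (u - t) ^ (1 - (H - 1 / 2)))) u := by
    intro u
    by_cases h : t < u
    · rw [Set.indicator_of_mem (by exact h), kernel, if_pos h, show H - 3 / 2 =
        -(1 - (H - 1 / 2)) by ring, Real.rpow_neg (by linarith)]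
      ring
    · rw [Set.indicator_of_notMem (by exact h), kernel, if_neg h, mul_zero]
  simp only [h1]
  rw [integral_indicator measurableSet_Ioi, Measure.restrict_restrict measurableSet_Ioi,
    integral_const_mul, show Set.Ioi t ∩ Set.Icc 0 1 = Set.Ioc t 1 from ?_, transferOne,
    kernelConst]
  · ring
  · ext x
    simp only [Set.mem_inter_iff, Set.mem_Ioi, Set.mem_Icc, Set.mem_Ioc]
    constructor
    · rintro ⟨h1, h2, h3⟩; exact ⟨h1, h3⟩
    · rintro ⟨h1, h2⟩; exact ⟨h1, ht.trans h1.le, h2⟩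

/-- The kernel `K` of the transfer operator is a square root of `ψ`:
`∫ K(t, u) K(t, v) dt = ψ(u, v)`. -/
lemma lintegral_kernel_mul (hH : 1 / 2 < H) (hH1 : H < 1) {u v : ℝ} (hu : u ∈ Set.Ioc (0 : ℝ) 1)
    (hv : v ∈ Set.Ioc (0 : ℝ) 1) (huv : u ≠ v) :
    ∫⁻ t, ENNReal.ofReal (kernel H t u) * ENNReal.ofReal (kernel H t v) ∂lebI =
      ENNReal.ofReal (psi H u v) := by
  wlog h : u < v generalizing u v
  · have h2 := this hv hu huv.symm (lt_of_le_of_ne (not_lt.1 h) huv.symm)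
    simp only [mul_comm (ENNReal.ofReal (kernel H _ u))]
    rw [h2, psi, psi, abs_sub_comm]
  have hc : 0 ≤ kernelConst H ^ 2 * (u * v) ^ (H - 1 / 2) :=
    mul_nonneg (sq_nonneg _) (Real.rpow_nonneg (mul_nonneg hu.1.le hv.1.le) _)
  have e : ∀ t ∈ Set.Ioo 0 u, ENNReal.ofReal (kernel H t u) * ENNReal.ofReal (kernel H t v) =
      ENNReal.ofReal (kernelConst H ^ 2 * (u * v) ^ (H - 1 / 2)) *
        ENNReal.ofReal (t ^ (1 - 2 * H) * (u - t) ^ (H - 3 / 2) * (v - t) ^ (H - 3 / 2)) := by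
    rintro t ⟨h0, h1⟩
    rw [← ENNReal.ofReal_mul (kernel_nonneg hH h0.le), ← ENNReal.ofReal_mul hc, kernel, kernel,
      if_pos h1, if_pos (h1.trans h), Real.mul_rpow hu.1.le hv.1.le,
      show 1 - 2 * H = (1 / 2 - H) + (1 / 2 - H) by ring, Real.rpow_add h0]
    congr 1
    ring
  have hsub : Set.Ioo 0 u ⊆ Set.Icc (0 : ℝ) 1 := fun t ht => ⟨ht.1.le, ht.2.le.trans hu.2⟩
  rw [← lintegral_inter_add_sdiff (μ := volume) _ (Set.Icc 0 1)
      (measurableSet_Ioo (a := 0) (b := u)),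
    Set.inter_eq_right.2 hsub, setLIntegral_congr_fun measurableSet_Ioo e,
    lintegral_const_mul' _ _ ENNReal.ofReal_ne_top,
    lintegral_beta_kernel (by linarith) (by linarith) (by ring) hu.1 h,
    ← ENNReal.ofReal_mul hc]
  have hz : ∫⁻ t in Set.Icc 0 1 \ Set.Ioo 0 u,
      ENNReal.ofReal (kernel H t u) * ENNReal.ofReal (kernel H t v) = 0 := by
    rw [setLIntegral_eq_zero_iff (measurableSet_Icc.diff measurableSet_Ioo)]
    · have h0 : ∀ᵐ t : ℝ, t ≠ 0 := by simp [ae_iff]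
      filter_upwards [h0] with t ht ⟨h1, h2⟩
      have h3 : ¬ t < u := fun h3 => h2 ⟨lt_of_le_of_ne h1.1 ht.symm, h3⟩
      simp [kernel, h3]
    · have := measurable_kernel H
      fun_prop
  rw [hz, add_zero]
  congr 1
  have hpos := Real.rpow_pos_of_pos (mul_pos hu.1 hv.1) (H - 1 / 2)
  rw [psi, abs_sub_comm, abs_of_pos (sub_pos.2 h), ← kernelConst_sq_mul_beta hH hH1,
    show -(H - 3 / 2) - 1 = -(H - 1 / 2) by ring, show -(1 - 2 * H) - 1 = 2 * H - 2 by ring,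
    Real.rpow_neg (mul_pos hu.1 hv.1).le]
  generalize (u * v) ^ (H - 1 / 2) = A at *
  field_simp

lemma ae_lintegral_kernel_mul (hH : 1 / 2 < H) (hH1 : H < 1) :
    ∀ᵐ p ∂(lebI.prod lebI),
      ∫⁻ t, ENNReal.ofReal (kernel H t p.1) * ENNReal.ofReal (kernel H t p.2) ∂lebI =
        ENNReal.ofReal (psi H p.1 p.2) := by
  have h1 : ∀ᵐ y ∂lebI, y ∈ Set.Ioc (0 : ℝ) 1 := by
    have h1 : ∀ᵐ y : ℝ, y ≠ 0 := by simp [ae_iff]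
    filter_upwards [ae_restrict_mem measurableSet_Icc, ae_restrict_of_ae h1] with y h2 h3
    exact ⟨lt_of_le_of_ne h2.1 h3.symm, h2.2⟩
  have h2 : ∀ᵐ p ∂(lebI.prod lebI), p.1 ≠ p.2 := by
    have hm : MeasurableSet {p : ℝ × ℝ | p.1 ≠ p.2} :=
      (measurableSet_eq_fun measurable_fst measurable_snd).compl
    rw [Measure.ae_prod_iff_ae_ae hm]
    refine .of_forall fun x => ?_
    refine ae_restrict_of_ae ?_
    simp [ae_iff]
  filter_upwards [h2, Measure.quasiMeasurePreserving_fst.ae h1,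
    Measure.quasiMeasurePreserving_snd.ae h1] with p e1 e2 e3
  exact lintegral_kernel_mul hH hH1 e2 e3 e1

end Fractional

/-! ### The transfer operator as an isometry -/

section TransferL2

open scoped ENNReal

variable {H : ℝ} {f g : ℝ → ℝ}

/-- The condition `f ∈ |𝓗|` for a function of one real variable, in terms of the lower Lebesgue
integral. -/
def FiniteEnergy (H : ℝ) (f : ℝ → ℝ) : Prop :=
  AEStronglyMeasurable f lebI ∧
    ∫⁻ p, ‖f p.1‖ₑ * ‖f p.2‖ₑ * ENNReal.ofReal (psi H p.1 p.2) ∂(lebI.prod lebI) < ∞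

/-- The transfer operator applied to `|f|`, with values in `[0, ∞]`. -/
noncomputable def absTransfer (H : ℝ) (f : ℝ → ℝ) (t : ℝ) : ℝ≥0∞ :=
  ∫⁻ u, ‖f u‖ₑ * ENNReal.ofReal (kernel H t u) ∂lebI

/-- By Tonelli's theorem and the square root property of the kernel, the pairing of the transformed
functions is the mutual energy of the functions. -/
lemma lintegral_absTransfer_mul (hH : 1 / 2 < H) (hH1 : H < 1) (hf : AEStronglyMeasurable f lebI)
    (hg : AEStronglyMeasurable g lebI) :
    ∫⁻ t, absTransfer H f t * absTransfer H g t ∂lebI =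
      ∫⁻ p, ‖f p.1‖ₑ * ‖g p.2‖ₑ * ENNReal.ofReal (psi H p.1 p.2) ∂(lebI.prod lebI) := by
  have hk : ∀ t, Measurable (kernel H t) := fun t => (measurable_kernel H).of_uncurry_left
  have h1 : ∀ t, absTransfer H f t * absTransfer H g t =
      ∫⁻ p : ℝ × ℝ, (‖f p.1‖ₑ * ENNReal.ofReal (kernel H t p.1)) *
        (‖g p.2‖ₑ * ENNReal.ofReal (kernel H t p.2)) ∂(lebI.prod lebI) := by
    intro t
    exact (lintegral_prod_mul (f := fun u => ‖f u‖ₑ * ENNReal.ofReal (kernel H t u))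
      (g := fun u => ‖g u‖ₑ * ENNReal.ofReal (kernel H t u))
      (hf.enorm.mul (hk t).ennreal_ofReal.aemeasurable)
      (hg.enorm.mul (hk t).ennreal_ofReal.aemeasurable)).symm
  simp only [h1]
  have hf1 : AEMeasurable (fun q : ℝ × ℝ × ℝ => ‖f q.2.1‖ₑ) (lebI.prod (lebI.prod lebI)) :=
    (hf.enorm.comp_fst (ν := lebI)).comp_snd (μ := lebI)
  have hg1 : AEMeasurable (fun q : ℝ × ℝ × ℝ => ‖g q.2.2‖ₑ) (lebI.prod (lebI.prod lebI)) :=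
    (hg.enorm.comp_snd (μ := lebI)).comp_snd (μ := lebI)
  have hk1 : Measurable fun q : ℝ × ℝ × ℝ => kernel H q.1 q.2.1 :=
    (measurable_kernel H).comp (measurable_fst.prodMk (measurable_fst.comp measurable_snd))
  have hk2 : Measurable fun q : ℝ × ℝ × ℝ => kernel H q.1 q.2.2 :=
    (measurable_kernel H).comp (measurable_fst.prodMk (measurable_snd.comp measurable_snd))
  rw [lintegral_lintegral_swap ((hf1.mul hk1.ennreal_ofReal.aemeasurable).mul
    (hg1.mul hk2.ennreal_ofReal.aemeasurable))]
  refine lintegral_congr_ae ?_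
  filter_upwards [ae_lintegral_kernel_mul hH hH1] with p hp
  rw [← hp, ← lintegral_const_mul' _ _ (by simp [ENNReal.mul_eq_top])]
  refine lintegral_congr fun t => ?_
  ring

lemma FiniteEnergy.lintegral_absTransfer_sq (hH : 1 / 2 < H) (hH1 : H < 1)
    (hf : FiniteEnergy H f) : ∫⁻ t, absTransfer H f t * absTransfer H f t ∂lebI < ∞ := by
  rw [lintegral_absTransfer_mul hH hH1 hf.1 hf.1]
  exact hf.2

lemma aemeasurable_absTransfer (H : ℝ) (hf : AEStronglyMeasurable f lebI) :
    AEMeasurable (absTransfer H f) lebI :=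
  AEMeasurable.lintegral_prod_right' (f := fun q : ℝ × ℝ => ‖f q.2‖ₑ *
    ENNReal.ofReal (kernel H q.1 q.2)) ((hf.enorm.comp_snd (μ := lebI)).mul
      (measurable_kernel H).ennreal_ofReal.aemeasurable)

/-- Finiteness of the mutual energy of two functions of finite energy follows from
`a b ≤ a² + b²`, applied to the transformed functions. -/
lemma FiniteEnergy.lintegral_mul_lt_top (hH : 1 / 2 < H) (hH1 : H < 1)
    (hf : FiniteEnergy H f) (hg : FiniteEnergy H g) :
    ∫⁻ t, absTransfer H f t * absTransfer H g t ∂lebI < ∞ := by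
  have h : ∀ a b : ℝ≥0∞, a * b ≤ a * a + b * b := by
    intro a b
    rcases le_total a b with hab | hab
    · exact (mul_le_mul_left hab b).trans le_add_self
    · exact (mul_le_mul_right hab a).trans le_self_add
  refine (lintegral_mono fun t => h _ _).trans_lt ?_
  rw [lintegral_add_left' (f := fun t => absTransfer H f t * absTransfer H f t)
    ((aemeasurable_absTransfer H hf.1).mul (aemeasurable_absTransfer H hf.1))]
  exact ENNReal.add_lt_top.2 ⟨hf.lintegral_absTransfer_sq hH hH1,
    hg.lintegral_absTransfer_sq hH hH1⟩

lemma ae_transferOne_eq (H : ℝ) (f : ℝ → ℝ) :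
    transferOne H f =ᵐ[lebI] fun t => ∫ u, f u * kernel H t u ∂lebI := by
  filter_upwards [ae_restrict_mem measurableSet_Icc] with t ht
  exact transferOne_eq f ht.1

lemma FiniteEnergy.memLp_transferOne (hH : 1 / 2 < H) (hH1 : H < 1) (hf : FiniteEnergy H f) :
    MemLp (transferOne H f) 2 lebI := by
  refine MemLp.ae_eq (ae_transferOne_eq H f).symm ⟨?_, ?_⟩
  · exact AEStronglyMeasurable.integral_prod_right' (f := fun q : ℝ × ℝ => f q.2 *
      kernel H q.1 q.2) ((hf.1.comp_snd (μ := lebI)).mul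
        (measurable_kernel H).aestronglyMeasurable)
  · rw [eLpNorm_lt_top_iff_lintegral_rpow_enorm_lt_top two_ne_zero ENNReal.ofNat_ne_top]
    refine lt_of_le_of_lt ?_ (hf.lintegral_absTransfer_sq hH hH1)
    refine lintegral_mono_ae ?_
    filter_upwards [ae_restrict_mem measurableSet_Icc] with t ht
    have h1 : ‖∫ u, f u * kernel H t u ∂lebI‖ₑ ≤ absTransfer H f t := by
      refine (enorm_integral_le_lintegral_enorm _).trans (le_of_eq ?_)
      refine lintegral_congr fun u => ?_
      rw [enorm_mul, Real.enorm_of_nonneg (kernel_nonneg hH ht.1)]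
    rw [ENNReal.toReal_ofNat, ENNReal.rpow_two, sq]
    exact mul_le_mul' h1 h1

/-- The transfer operator is an isometry from `𝓗` to `L²([0,1])`. -/
lemma FiniteEnergy.integral_transferOne_mul (hH : 1 / 2 < H) (hH1 : H < 1)
    (hf : FiniteEnergy H f) (hg : FiniteEnergy H g) :
    ∫ t, transferOne H f t * transferOne H g t ∂lebI =
      ∫ p, f p.1 * g p.2 * psi H p.1 p.2 ∂(lebI.prod lebI) := by
  have h1 : ∫ t, transferOne H f t * transferOne H g t ∂lebI =
      ∫ t, ∫ p : ℝ × ℝ, (f p.1 * kernel H t p.1) * (g p.2 * kernel H t p.2)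
        ∂(lebI.prod lebI) ∂lebI := by
    refine integral_congr_ae ?_
    filter_upwards [ae_transferOne_eq H f, ae_transferOne_eq H g] with t e1 e2
    rw [e1, e2, ← integral_prod_mul]
  have hk1 : Measurable fun q : ℝ × ℝ × ℝ => kernel H q.1 q.2.1 :=
    (measurable_kernel H).comp (measurable_fst.prodMk (measurable_fst.comp measurable_snd))
  have hk2 : Measurable fun q : ℝ × ℝ × ℝ => kernel H q.1 q.2.2 :=
    (measurable_kernel H).comp (measurable_fst.prodMk (measurable_snd.comp measurable_snd))
  have hf1 : AEStronglyMeasurable (fun q : ℝ × ℝ × ℝ => f q.2.1) (lebI.prod (lebI.prod lebI)) :=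
    (hf.1.comp_fst (ν := lebI)).comp_snd (μ := lebI)
  have hg1 : AEStronglyMeasurable (fun q : ℝ × ℝ × ℝ => g q.2.2) (lebI.prod (lebI.prod lebI)) :=
    (hg.1.comp_snd (μ := lebI)).comp_snd (μ := lebI)
  have hm : AEStronglyMeasurable (fun q : ℝ × ℝ × ℝ => (f q.2.1 * kernel H q.1 q.2.1) *
      (g q.2.2 * kernel H q.1 q.2.2)) (lebI.prod (lebI.prod lebI)) :=
    (hf1.mul hk1.aestronglyMeasurable).mul (hg1.mul hk2.aestronglyMeasurable)
  have hint : Integrable (fun q : ℝ × ℝ × ℝ => (f q.2.1 * kernel H q.1 q.2.1) *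
      (g q.2.2 * kernel H q.1 q.2.2)) (lebI.prod (lebI.prod lebI)) := by
    refine ⟨hm, ?_⟩
    rw [hasFiniteIntegral_iff_enorm, lintegral_prod _ hm.enorm]
    refine lt_of_le_of_lt (le_of_eq ?_) (hf.lintegral_mul_lt_top hH hH1 hg)
    refine lintegral_congr_ae ?_
    filter_upwards [ae_restrict_mem measurableSet_Icc] with t ht
    have hk : Measurable (kernel H t) := (measurable_kernel H).of_uncurry_left
    rw [absTransfer, absTransfer, ← lintegral_prod_mul
      (f := fun u => ‖f u‖ₑ * ENNReal.ofReal (kernel H t u))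
      (g := fun u => ‖g u‖ₑ * ENNReal.ofReal (kernel H t u))
      (hf.1.enorm.mul hk.ennreal_ofReal.aemeasurable)
      (hg.1.enorm.mul hk.ennreal_ofReal.aemeasurable)]
    refine lintegral_congr fun p => ?_
    rw [enorm_mul, enorm_mul, enorm_mul, Real.enorm_of_nonneg (kernel_nonneg hH ht.1),
      Real.enorm_of_nonneg (kernel_nonneg hH ht.1)]
  rw [h1, integral_integral_swap hint]
  refine integral_congr_ae ?_
  filter_upwards [ae_lintegral_kernel_mul hH hH1] with p hp
  have h2 : ∫ t, kernel H t p.1 * kernel H t p.2 ∂lebI = psi H p.1 p.2 := by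
    have hk1 : Measurable fun t => kernel H t p.1 := (measurable_kernel H).of_uncurry_right
    have hk2 : Measurable fun t => kernel H t p.2 := (measurable_kernel H).of_uncurry_right
    have hpos : ∀ᵐ t ∂lebI, 0 ≤ kernel H t p.1 * kernel H t p.2 := by
      filter_upwards [ae_restrict_mem measurableSet_Icc] with t ht
      exact mul_nonneg (kernel_nonneg hH ht.1) (kernel_nonneg hH ht.1)
    rw [integral_eq_lintegral_of_nonneg_ae hpos (hk1.mul hk2).aestronglyMeasurable,
      ← ENNReal.toReal_ofReal (psi_nonneg hH p.1 p.2), ← hp]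
    congr 1
    refine lintegral_congr_ae ?_
    filter_upwards [ae_restrict_mem measurableSet_Icc] with t ht
    rw [ENNReal.ofReal_mul (kernel_nonneg hH ht.1)]
  rw [← h2, ← integral_const_mul]
  refine integral_congr_ae (.of_forall fun t => ?_)
  dsimp only
  ring

instance : IsProbabilityMeasure lebI := ⟨by simp⟩

lemma measurePreserving_cube_one :
    MeasurePreserving (fun x : Fin 1 → ℝ => x 0) (cube 1) lebI :=
  measurePreserving_eval (fun _ : Fin 1 => lebI) 0

end TransferL2

/-! ### Tensor products in `|𝓗|^{⊗n}` -/

section AbsH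

variable {H : ℝ}

lemma measurePreserving_cube_one_prod :
    MeasurePreserving (fun p : (Fin 1 → ℝ) × (Fin 1 → ℝ) => (p.1 0, p.2 0))
      ((cube 1).prod (cube 1)) (lebI.prod lebI) :=
  measurePreserving_cube_one.prod measurePreserving_cube_one

lemma measurableEmbedding_eval_zero :
    MeasurableEmbedding fun x : Fin 1 → ℝ => x 0 :=
  (MeasurableEquiv.funUnique (Fin 1) ℝ).measurableEmbedding

lemma MemAbsH.integrable_single {f : ℝ → ℝ} (hf : MemAbsH H (single f)) :
    AEStronglyMeasurable f lebI ∧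
      Integrable (fun p : ℝ × ℝ => |f p.1 * f p.2| * psi H p.1 p.2) (lebI.prod lebI) := by
  refine ⟨?_, ?_⟩
  · exact (measurePreserving_cube_one.aestronglyMeasurable_comp_iff
      measurableEmbedding_eval_zero).1 hf.1
  · refine (measurePreserving_cube_one_prod.integrable_comp_emb
      (measurableEmbedding_eval_zero.prodMap measurableEmbedding_eval_zero)).1 ?_
    simpa [single, Function.comp_def] using! hf.2

lemma MemAbsH.finiteEnergy (hH : 1 / 2 < H) {f : ℝ → ℝ} (hf : MemAbsH H (single f)) :
    FiniteEnergy H f := by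
  obtain ⟨h1, h2⟩ := hf.integrable_single
  refine ⟨h1, ?_⟩
  have h3 := h2.2
  rw [hasFiniteIntegral_iff_enorm] at h3
  refine lt_of_le_of_lt (le_of_eq (lintegral_congr fun p => ?_)) h3
  rw [enorm_mul, Real.enorm_abs, enorm_mul, Real.enorm_of_nonneg (psi_nonneg hH _ _)]

lemma innerH_single (H : ℝ) (f g : ℝ → ℝ) :
    innerH H (single f) (single g) =
      ∫ p, f p.1 * g p.2 * psi H p.1 p.2 ∂(lebI.prod lebI) := by
  rw [innerH, ← measurePreserving_cube_one_prod.integral_comp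
    (measurableEmbedding_eval_zero.prodMap measurableEmbedding_eval_zero)]
  simp [single]

/-- The energy integral of a tensor product factorizes, after regrouping the `2n` variables into the
pairs `(u_j, v_j)`. -/
lemma memAbsH_tensor {n : ℕ} {f : Fin n → ℝ → ℝ}
    (hf : ∀ i, MemAbsH H (single (f i))) : MemAbsH H (tensor f) := by
  refine ⟨Finset.aestronglyMeasurable_fun_prod _ fun i _ =>
    ((hf i).integrable_single).1.comp_quasiMeasurePreserving
      (Measure.quasiMeasurePreserving_eval (fun _ : Fin n => lebI) i), ?_⟩
  have h1 := Integrable.fintype_prod (μ := fun _ : Fin n => lebI.prod lebI)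
    (f := fun i (p : ℝ × ℝ) => |f i p.1 * f i p.2| * psi H p.1 p.2)
    fun i => ((hf i).integrable_single).2
  have h2 := (measurePreserving_arrowProdEquivProdArrow ℝ ℝ (Fin n) (fun _ => lebI)
    (fun _ => lebI)).symm
  refine ((h2.integrable_comp_emb (MeasurableEquiv.measurableEmbedding _)).2 h1).congr
    (.of_forall fun p => ?_)
  simp only [Function.comp, tensor, Finset.prod_mul_distrib, abs_mul, Finset.abs_prod]
  rfl

end AbsH

end FractionalChaos

theorem lemma5 {Ω : Type*} [MeasurableSpace Ω] (P : Measure Ω) [IsProbabilityMeasure P]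
    (W : unitInterval → Ω → ℝ) (hW : FractionalChaos.IsWienerProcess W P)
    (H : ℝ) (hH : 1 / 2 < H) (hH1 : H < 1)
    (n : ℕ) (f : Fin n → ℝ → ℝ)
    (hf : ∀ i, FractionalChaos.MemAbsH H (FractionalChaos.single (f i))) :
    FractionalChaos.MemAbsH H (FractionalChaos.tensor f) ∧
    FractionalChaos.IsMultipleIntegral W P
      (FractionalChaos.transfer H (FractionalChaos.tensor f))
      (FractionalChaos.fractionalIntegral W P H (FractionalChaos.tensor f)) ∧
    ∀ᵐ ω ∂P,
      FractionalChaos.fractionalIntegral W P H (FractionalChaos.tensor f) ω =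
        (∏ i, FractionalChaos.fractionalIntegral W P H (FractionalChaos.single (f i)) ω) +
        ∑ l ∈ Finset.Icc 1 (n / 2), (-1 : ℝ) ^ l / (2 ^ l * (l.factorial : ℝ)) *
          ∑ k : Fin (2 * l) ↪ Fin n,
            (∏ u ∈ Finset.univ.filter (fun u : Fin n => ∀ m, k m ≠ u),
              FractionalChaos.fractionalIntegral W P H (FractionalChaos.single (f u)) ω) *
            ∏ j : Fin l,
              FractionalChaos.innerH H
                (FractionalChaos.single (f (k ⟨2 * (j : ℕ), by omega⟩)))
                (FractionalChaos.single (f (k ⟨2 * (j : ℕ) + 1, by omega⟩))) := by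
  have hE : ∀ i, FractionalChaos.FiniteEnergy H (f i) := fun i => (hf i).finiteEnergy hH
  have hG : ∀ i, MemLp (FractionalChaos.transferOne H (f i)) 2 FractionalChaos.lebI :=
    fun i => (hE i).memLp_transferOne hH hH1
  refine ⟨FractionalChaos.memAbsH_tensor hf, ?_, ?_⟩
  · rw [FractionalChaos.fractionalIntegral, FractionalChaos.transfer_tensor]
    exact hW.isMultipleIntegral_multipleIntegral (FractionalChaos.memLp_prod hG)
  · have h := hW.multipleIntegral_prod_eq hG
    simp only [fun i j => (hE i).integral_transferOne_mul hH hH1 (hE j)] at h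
    simp only [FractionalChaos.fractionalIntegral, FractionalChaos.transfer_tensor,
      FractionalChaos.transfer_single, FractionalChaos.innerH_single]
    exact h
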